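/- Let $\ell\ge 4$ be an odd integer and let $\Phi$ be a (reduced, crystallographic) root system of type $D_\ell$ in a Euclidean space $E$, with simple roots $\alpha_1,\dots,\alpha_\ell$ numbered so that $\alpha_1,\dots,\alpha_{\ell-2}$ form a chain in the Dynkin diagram and $\alpha_{\ell-1},\alpha_\ell$ are both joined to $\alpha_{\ell-2}$. Let $W$ be its Weyl group and $Z=\{x\in E : (\alpha,x)\in\mathbb Z \text{ for all }\alpha\in\Phi\}$ its coweight lattice. For an integer $q\ge 1$ let $\pi_q:Z\to Z/qZ$ be the projection and let $$M(\Phi;q)=\{\pi_q(x)\in Z/qZ : (\alpha,x)\not\equiv 0 \pmod q \text{ for all }\alpha\in\Phi\},$$ on which $W$ acts by $w\,\pi_q(x)=\pi_q(w x)$. Let $\chi_{\Phi,q}$ be the permutation character of $W$ on $M(\Phi;q)$, so $\chi_{\Phi,q}(w)$ is the number of points of $M(\Phi;q)$ fixed by $w$. For $j\in\{1,\ell-1,\ell\}$ put $\omega_j=w_jw_0$, where $w_0$ is the longest element of $W$ and $w_j$ is the longest element of the parabolic subgroup generated by the reflections in the simple roots other than $\alpha_j$. **Theorem.** For every integer $q\ge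 1$: 1. $\chi_{\Phi,q}(1)=(q-1)(q-3)\cdots(q-(2\ell-3))\,(q-(\ell-1))$ if $q$ is odd, and $\chi_{\Phi,q}(1)=(q-2)(q-4)\cdots(q-2(\ell-2))\left(q^2-2(\ell-1)q+\frac{\ell(\ell-1)}2\right)$ if $q$ is even. 2. $\chi_{\Phi,q}(\omega_1)=0$ if $q$ is odd, and $\chi_{\Phi,q}(\omega_1)=(q-2)(q-4)\cdots(q-2(\ell-2))$ if $q$ is even. 3. Each $\omega\in\{\omega_{\ell-1},\omega_\ell\}$ has order $4$, and $\chi_{\Phi,q}(\omega)=0$ if $4\nmid q$, while $\chi_{\Phi,q}(\omega)=2(q-4)(q-8)\cdots(q-2(\ell-3))$ if $4\mid q$. -/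

import Mathlib

/-!
Conventions.  A root system in a Euclidean space `E` is a Mathlib root system
`P : RootPairing ι ℝ M N`: the roots `α = P.root i` live in `M`, and `N` is the dual space, which
for a Euclidean space is identified with `E` through the inner product, so that
`P.root' i x = (α, x)` and `P.coroot i` is `α^∨ = 2α / (α, α)`.
-/

namespace EquivariantQuasi

noncomputable section

/-! ### Length and longest elements -/

/-- The length of `w` with respect to `S`: the least length of a word in `S` with product `w`
(used only for generating sets made of involutions). -/
def wordLength {G : Type*} [Group G] (S : Set G) (w : G) : ℕ :=
  sInf {n : ℕ | ∃ l : List G, (∀ s ∈ l, s ∈ S) ∧ l.prod = w ∧ l.length = n}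

/-- `w` is an element of maximal length in the subgroup generated by `S`. -/
def IsLongest {G : Type*} [Group G] (S : Set G) (w : G) : Prop :=
  w ∈ Subgroup.closure S ∧
    ∀ v ∈ Subgroup.closure S, wordLength S v ≤ wordLength S w

theorem exists_isLongest {G : Type*} [Group G] [Finite G] (S : Set G) :
    ∃ w, IsLongest S w := by
  obtain ⟨w, hw, h⟩ := Set.exists_max_image (Subgroup.closure S : Set G) (wordLength S)
    (Set.toFinite _) ⟨1, Subgroup.one_mem _⟩
  exact ⟨w, hw, h⟩

/-- The longest element of the subgroup generated by `S`. -/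
def longestElement {G : Type*} [Group G] (S : Set G) : G :=
  Classical.epsilon (IsLongest S)

section RootSystem

variable {ι M N : Type*} [AddCommGroup M] [Module ℝ M] [AddCommGroup N] [Module ℝ N]

/-! ### The Weyl group and its action on the coweight lattice -/

/-- The linear action of the Weyl group `W` on the space `N` containing the coweight lattice.
Mathlib's `coweightEquiv` is contravariant, hence the inverse. -/
def coweightAction (P : RootPairing ι ℝ M N) : P.weylGroup →* (N ≃ₗ[ℝ] N) where
  toFun w := RootPairing.Equiv.coweightEquiv P P (w : RootPairing.Aut P)⁻¹
  map_one' := by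
    ext x
    simp
  map_mul' v w := by
    rw [Subgroup.coe_mul, mul_inv_rev]
    exact congrArg MulOpposite.unop
      (map_mul (RootPairing.Equiv.coweightHom P) (w : RootPairing.Aut P)⁻¹ (v : RootPairing.Aut P)⁻¹)

/-- The reflection in the root `α` acts by `x ↦ x - (α, x) α^∨`. -/
theorem coweightAction_ofIdx (P : RootPairing ι ℝ M N) (i : ι) (x : N) :
    coweightAction P (RootPairing.weylGroup.ofIdx P i) x = x - P.root' i x • P.coroot i := by
  change RootPairing.Equiv.coweightEquiv P P (RootPairing.Equiv.reflection P i)⁻¹ x = _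
  rw [RootPairing.Equiv.reflection_inv, RootPairing.Equiv.reflection_coweightEquiv,
    RootPairing.coreflection_apply]

theorem root'_coweightAction (P : RootPairing ι ℝ M N) (w : P.weylGroup) (i : ι) (x : N) :
    P.root' i (coweightAction P w x) = P.root' (P.weylGroupToPerm w⁻¹ i) x := by
  have h := RootPairing.Hom.weight_coweight_transpose_apply P P x (w⁻¹ : P.weylGroup).1.toHom
  have h' := LinearMap.congr_fun h (P.root i)
  rw [LinearMap.dualMap_apply, RootPairing.Hom.root_weightMap_apply] at h'
  exact h'.symm

/-- The Weyl group of a root system is finite, so its longest elements exist. -/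
theorem finite_weylGroup [Finite ι] (P : RootPairing ι ℝ M N) [P.IsRootSystem] :
    Finite P.weylGroup := by
  have hinj : Function.Injective P.weylGroupToPerm := by
    intro v w h
    apply Subtype.ext
    apply RootPairing.Equiv.weightHom_injective P
    apply LinearEquiv.toLinearMap_injective
    refine LinearMap.ext_on_range (v := P.root) ?_ fun i => ?_
    · exact RootPairing.IsRootSystem.span_root_eq_top
    · have hv := P.weylGroup_apply_root v i
      have hw := P.weylGroup_apply_root w i
      rw [h, ← hw] at hv
      exact hv
  exact Finite.of_injective _ hinj

/-- The coweight lattice `Z = {x | (α, x) ∈ ℤ for all roots α}`. -/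
def coweightLattice (P : RootPairing ι ℝ M N) : AddSubgroup N where
  carrier := {x | ∀ i, ∃ m : ℤ, P.root' i x = m}
  zero_mem' := fun i => ⟨0, by simp⟩
  add_mem' := by
    intro x y hx hy i
    obtain ⟨m, hm⟩ := hx i
    obtain ⟨n, hn⟩ := hy i
    exact ⟨m + n, by rw [map_add, hm, hn, Int.cast_add]⟩
  neg_mem' := by
    intro x hx i
    obtain ⟨m, hm⟩ := hx i
    exact ⟨-m, by rw [map_neg, hm, Int.cast_neg]⟩

/-- The action of an element of `W` on `Z`. -/
def latticeAction (P : RootPairing ι ℝ M N) (w : P.weylGroup) :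
    coweightLattice P →+ coweightLattice P where
  toFun x := ⟨coweightAction P w x, fun i => by
    obtain ⟨m, hm⟩ := x.2 (P.weylGroupToPerm w⁻¹ i)
    exact ⟨m, by rw [root'_coweightAction, hm]⟩⟩
  map_zero' := by ext; simp
  map_add' x y := by ext; simp

/-! ### Reduction modulo `q` -/

/-- The sublattice `qZ` of `Z`. -/
def multiples (P : RootPairing ι ℝ M N) (q : ℕ) : AddSubgroup (coweightLattice P) :=
  (nsmulAddMonoidHom (α := coweightLattice P) q).range

/-- The finite abelian group `Z / qZ`. -/
abbrev ModLattice (P : RootPairing ι ℝ M N) (q : ℕ) : Type _ :=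
  coweightLattice P ⧸ multiples P q

/-- The action `π_q(x) ↦ π_q(w x)` of `w ∈ W` on `Z / qZ`. -/
def modAction (P : RootPairing ι ℝ M N) (q : ℕ) (w : P.weylGroup) :
    ModLattice P q →+ ModLattice P q :=
  QuotientAddGroup.map (multiples P q) (multiples P q) (latticeAction P w) (by
    rintro _ ⟨x, rfl⟩
    exact ⟨latticeAction P w x, by simp⟩)

/-- The mod `q` complement of the Coxeter arrangement:
`M(Φ; q) = {π_q(x) ∈ Z / qZ | (α, x) ≢ 0 (mod q) for all roots α}`. -/
def modComplement (P : RootPairing ι ℝ M N) (q : ℕ) : Set (ModLattice P q) :=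
  {y | ∃ x : coweightLattice P, (x : ModLattice P q) = y ∧
    ∀ i, ¬ ∃ m : ℤ, P.root' i (x : N) = (q : ℝ) * m}

/-- The equivariant characteristic quasi-polynomial `χ_{Φ,q}`: the permutation character of `W`
on `M(Φ; q)`, whose value at `w` is the number of points of `M(Φ; q)` fixed by `w`. -/
def equivChar (P : RootPairing ι ℝ M N) (q : ℕ) (w : P.weylGroup) : ℕ :=
  Nat.card {y : ModLattice P q // y ∈ modComplement P q ∧ modAction P q w y = y}

/-! ### The elements `ω_j` -/

/-- The simple reflections in the simple roots whose index lies in `J`. -/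
def reflectionsIn (P : RootPairing ι ℝ M N) (J : Set ι) : Set P.weylGroup :=
  RootPairing.weylGroup.ofIdx P '' J

/-- `ω_j = w_j w_0`, where `w_0` is the longest element of `W` (with respect to the simple
reflections) and `w_j` is the longest element of the parabolic subgroup of `W` generated by the
reflections in the simple roots other than `α_j`. -/
def omega {P : RootPairing ι ℝ M N} (b : P.Base) (j : b.support) : P.weylGroup :=
  longestElement (reflectionsIn P {i | i ∈ b.support ∧ i ≠ j}) *
    longestElement (reflectionsIn P {i | i ∈ b.support})

/-- `e` is a numbering `α_1, …, α_ℓ` of the simple roots (`α_{i+1}` has index `i : Fin ℓ`) for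
which the Cartan matrix is that of `D_ℓ` in the usual numbering: `α_1, …, α_{ℓ-2}` is a chain and
`α_{ℓ-1}`, `α_ℓ` are both attached to `α_{ℓ-2}`. -/
def IsTypeD {P : RootPairing ι ℝ M N} [P.IsCrystallographic] (b : P.Base) {ℓ : ℕ}
    (e : Fin ℓ ≃ b.support) : Prop :=
  ∀ i j, b.cartanMatrix (e i) (e j) = CartanMatrix.D ℓ i j

end RootSystem

end

end EquivariantQuasi

/-! Put ℓ = n + 2 and use coordinates in which the simple roots are x_i - x_{i+1} and x_{ℓ-1} + x_ℓ
(`exists_isStandard`). All roots are then ±x_k ± x_l with k ≠ l, and the coweight lattice consists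
of the vectors with all coordinates in ℤ or all in ℤ + 1/2. After doubling, these are the integer
vectors of constant parity, and qZ becomes, modulo 2q, the two vectors (0,…,0) and (q,…,q). Hence a
point of M(Φ; q) has exactly two lifts to (ℤ/2q)^ℓ, differing by (q,…,q). The lifts are the tuples
of constant parity with y_k ≠ ±y_l for k ≠ l, and a point is fixed by w exactly when wy = y or wy =
y + (q,…,q). This is `two_mul_equivChar`: twice the character value is a count of tuples over ℤ/2q.

The Weyl group acts by signed permutations with an even number of signs. A longest element of a
parabolic subgroup makes the simple roots of that subgroup negative on the image of the vector
(ℓ-1,…,1,0), by the exchange argument. With the sign parity this determines the element. For ℓ odd,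
ω_1 changes the signs of the first and last coordinates, and ω_ℓ reverses the coordinates and
changes the sign of all but the first entry. The diagram symmetry exchanging the fork nodes reduces
ω_{ℓ-1} to ω_ℓ.

The remaining counts concern tuples with entries in pairwise different classes (`card_apartTuples`).
For the identity the classes are {a, -a}, which are singletons only for a = 0 and a = q. These have
different parities when q is odd and are both even when q is even, whence the two formulas. For ω_1
the two end entries must be 0 and q in some order. This is impossible for q odd, and for q even the
middle entries avoid both. For ω_ℓ the fixed tuples satisfy 2y_1 = 0 and y_{ℓ+1-j} = q - y_j. The
middle entry c then has 2c = q with c even, which forces 4 ∣ q. Such a tuple is given by its first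
half, whose inner entries lie in distinct four-element classes {±a, q ± a}. -/

namespace EquivariantQuasi

/-! ### Counting tuples of pairwise inequivalent elements -/

section Counting

variable {α : Type*} [DecidableEq α] [Fintype α]

/-- The tuples in `S` no two entries of which lie in a common class, where `K a` is the class
of `a`. -/
def apartTuples (K : α → Finset α) (n : ℕ) (S : Finset α) : Finset (Fin n → α) :=
  Finset.univ.filter fun y => (∀ i, y i ∈ S) ∧ ∀ i j, i ≠ j → y i ∉ K (y j)

theorem mem_apartTuples {K : α → Finset α} {n : ℕ} {S : Finset α} {y : Fin n → α} :
    y ∈ apartTuples K n S ↔ (∀ i, y i ∈ S) ∧ ∀ i j, i ≠ j → y i ∉ K (y j) := by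
  simp [apartTuples]

/-- Choose the first entry `a`; the others form such a tuple avoiding the class of `a`. Symmetry is
what makes this one-sided exclusion enough. -/
theorem card_apartTuples_succ (K : α → Finset α) (hsymm : ∀ a b, b ∈ K a → a ∈ K b) (n : ℕ)
    (S : Finset α) :
    (apartTuples K (n + 1) S).card = ∑ a ∈ S, (apartTuples K n (S \ K a)).card := by
  rw [← Finset.card_sigma]
  refine Finset.card_bij' (fun y _ => ⟨y 0, Fin.tail y⟩)
    (fun p _ => (Fin.cons p.1 p.2 : Fin (n + 1) → α)) ?_ ?_ ?_ ?_
  · intro y hy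
    rw [mem_apartTuples] at hy
    simp only [Finset.mem_sigma, mem_apartTuples, Finset.mem_sdiff]
    exact ⟨hy.1 0, fun i => ⟨hy.1 _, hy.2 _ _ (Fin.succ_ne_zero i)⟩,
      fun i j hij => hy.2 _ _ (fun h => hij (Fin.succ_injective _ h))⟩
  · rintro ⟨a, z⟩ hz
    simp only [Finset.mem_sigma, mem_apartTuples, Finset.mem_sdiff] at hz
    obtain ⟨ha, h1, h2⟩ := hz
    rw [mem_apartTuples]
    refine ⟨fun i => ?_, fun i j => ?_⟩
    · refine Fin.cases ?_ (fun i => ?_) i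
      · simpa using ha
      · simpa using (h1 i).1
    · refine Fin.cases ?_ (fun i => ?_) i <;> refine Fin.cases ?_ (fun j => ?_) j
      · simp
      · intro _
        simpa using fun h => (h1 j).2 (hsymm _ _ h)
      · intro _
        simpa using (h1 i).2
      · intro hij
        simpa using h2 i j (fun h => hij (by rw [h]))
  · intro y _
    simp
  · rintro ⟨a, z⟩ _
    simp

/-- The number of `n`-tuples of pairwise inequivalent elements when there are `f` singleton
classes and the other classes have `d` elements each, `m` in total. -/
def tupleCount (d : ℚ) : ℕ → ℚ → ℚ → ℚ
  | 0, _, _ => 1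
  | n + 1, m, f => f * tupleCount d n m (f - 1) + m * tupleCount d n (m - d) f

/-- Removing the class of the first entry takes away either one singleton class or one class of `d`
elements, which is the recursion of `tupleCount`. The set stays a union of classes, and `d ≠ 1`
keeps the two kinds apart. -/
theorem card_apartTuples (K : α → Finset α) (d : ℕ) (hd : d ≠ 1) (hself : ∀ a, a ∈ K a)
    (hclass : ∀ a b, b ∈ K a → K b = K a) (n : ℕ) (S : Finset α)
    (hS : ∀ a ∈ S, K a ⊆ S) (hcard : ∀ a ∈ S, (K a).card = 1 ∨ (K a).card = d) :
    ((apartTuples K n S).card : ℚ) = tupleCount d n (S.filter fun a => (K a).card = d).card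
      (S.filter fun a => (K a).card = 1).card := by
  have hsymm : ∀ a b, b ∈ K a → a ∈ K b := fun a b h => by rw [hclass a b h]; exact hself a
  induction n generalizing S with
  | zero =>
    have : apartTuples K 0 S = Finset.univ := by
      ext y
      simp [mem_apartTuples, Subsingleton.elim y default]
    simp [this, tupleCount]
  | succ n ih =>
    rw [card_apartTuples_succ K hsymm, Nat.cast_sum]
    have hsplit : S = (S.filter fun a => (K a).card = 1) ∪ S.filter fun a => (K a).card = d := by
      ext a
      simp only [Finset.mem_union, Finset.mem_filter]
      have := hcard a
      tauto
    have hdisj : Disjoint (S.filter fun a => (K a).card = 1)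
        (S.filter fun a => (K a).card = d) := by
      rw [Finset.disjoint_filter]
      intro a _ h1 h2
      exact hd (h2.symm.trans h1)
    have hstep : ∀ a ∈ S, ((apartTuples K n (S \ K a)).card : ℚ) =
        tupleCount d n ((S \ K a).filter fun a => (K a).card = d).card
          ((S \ K a).filter fun a => (K a).card = 1).card := by
      intro a ha
      apply ih
      · intro b hb c hc
        rw [Finset.mem_sdiff] at hb ⊢
        refine ⟨hS b hb.1 hc, fun hca => hb.2 ?_⟩
        rw [← hclass a c hca]
        exact hsymm _ _ hc
      · intro b hb
        exact hcard b (Finset.mem_sdiff.1 hb).1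
    conv_lhs => rw [hsplit]
    rw [Finset.sum_union hdisj, tupleCount]
    congr 1
    · rw [← nsmul_eq_mul]
      refine Finset.sum_eq_card_nsmul fun a ha => ?_
      rw [Finset.mem_filter] at ha
      rw [← hsplit, hstep a ha.1]
      have hKa : K a = {a} :=
        (Finset.eq_of_subset_of_card_le (Finset.singleton_subset_iff.2 (hself a))
          (by simp [ha.2])).symm
      congr 2
      · congr 1
        ext b
        simp only [Finset.mem_filter, Finset.mem_sdiff, hKa, Finset.mem_singleton]
        refine ⟨fun h => ⟨h.1.1, h.2⟩, fun h => ⟨⟨h.1, ?_⟩, h.2⟩⟩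
        rintro rfl
        exact hd (h.2.symm.trans ha.2)
      · have : ((S \ K a).filter fun a => (K a).card = 1) =
            (S.filter fun a => (K a).card = 1).erase a := by
          ext b
          simp only [Finset.mem_filter, Finset.mem_sdiff, hKa, Finset.mem_singleton,
            Finset.mem_erase]
          tauto
        rw [this, Finset.card_erase_of_mem (Finset.mem_filter.2 ha), Nat.cast_sub, Nat.cast_one]
        exact Finset.card_pos.2 ⟨a, Finset.mem_filter.2 ha⟩
    · rw [← nsmul_eq_mul]
      refine Finset.sum_eq_card_nsmul fun a ha => ?_
      rw [Finset.mem_filter] at ha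
      rw [← hsplit, hstep a ha.1]
      congr 2
      · have hsub : K a ⊆ S.filter fun a => (K a).card = d := by
          intro b hb
          rw [Finset.mem_filter, hclass a b hb]
          exact ⟨hS a ha.1 hb, ha.2⟩
        have : ((S \ K a).filter fun a => (K a).card = d) =
            (S.filter fun a => (K a).card = d) \ K a := by
          ext b
          simp only [Finset.mem_filter, Finset.mem_sdiff]
          tauto
        rw [this, Finset.card_sdiff_of_subset hsub, Nat.cast_sub (Finset.card_le_card hsub), ha.2]
      · congr 1
        ext b
        simp only [Finset.mem_filter, Finset.mem_sdiff]
        refine ⟨fun h => ⟨h.1.1, h.2⟩, fun h => ⟨⟨h.1, fun hb => ?_⟩, h.2⟩⟩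
        rw [hclass a b hb, ha.2] at h
        exact hd h.2

/-! ### Closed forms with zero, one or two singleton classes -/

theorem tupleCount_zero (d : ℚ) (n : ℕ) (m : ℚ) :
    tupleCount d n m 0 = ∏ i ∈ Finset.range n, (m - d * i) := by
  induction n generalizing m with
  | zero => simp [tupleCount]
  | succ n ih =>
    rw [tupleCount, ih, Finset.prod_range_succ', zero_mul, zero_add, mul_comm]
    congr 1
    · exact Finset.prod_congr rfl fun i _ => by push_cast; ring
    · simp

theorem mul_prod_range_sub (d : ℚ) (n : ℕ) (m : ℚ) :
    m * ∏ i ∈ Finset.range n, (m - d - d * i) =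
      (∏ i ∈ Finset.range n, (m - d * i)) * (m - d * n) := by
  rw [← Finset.prod_range_succ, Finset.prod_range_succ', mul_comm]
  congr 1
  · exact Finset.prod_congr rfl fun i _ => by push_cast; ring
  · simp

/-- The last factor separates the tuples that omit the singleton (`m - d * n`) from those that use
it, in one of `n + 1` positions. -/
theorem tupleCount_one (d : ℚ) (n : ℕ) (m : ℚ) :
    tupleCount d (n + 1) m 1 =
      (∏ i ∈ Finset.range n, (m - d * i)) * (m - d * n + (n + 1)) := by
  induction n generalizing m with
  | zero => simp [tupleCount]; ring
  | succ n ih =>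
    rw [tupleCount, ih, sub_self, tupleCount_zero, ← mul_assoc, mul_prod_range_sub,
      Finset.prod_range_succ]
    push_cast
    ring

/-- The three terms of the quadratic factor correspond to using none, one or both of the two
singletons; one singleton has `2 * (n + 2)` placements, both have `(n + 2) * (n + 1)`. -/
theorem tupleCount_two (n : ℕ) (m : ℚ) :
    tupleCount 2 (n + 2) m 2 = (∏ i ∈ Finset.range n, (m - 2 * i)) *
      ((m - 2 * n) * (m - 2 * n - 2) + 2 * (n + 2) * (m - 2 * n) + (n + 2) * (n + 1)) := by
  induction n generalizing m with
  | zero => simp [tupleCount]; norm_num; ring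
  | succ n ih =>
    rw [tupleCount, ih, show (2 : ℚ) - 1 = 1 by norm_num, tupleCount_one, ← mul_assoc m,
      mul_prod_range_sub, Finset.prod_range_succ]
    push_cast
    ring

end Counting

/-! ### Descents of longest elements -/

section Descent

variable {ι M N : Type*} [AddCommGroup M] [Module ℝ M] [AddCommGroup N] [Module ℝ N]

theorem coweightAction_injective (P : RootPairing ι ℝ M N) :
    Function.Injective (coweightAction P) := by
  intro v w h
  have h' : RootPairing.Equiv.coweightHom P (v : RootPairing.Aut P)⁻¹ =
      RootPairing.Equiv.coweightHom P (w : RootPairing.Aut P)⁻¹ := congrArg MulOpposite.op h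
  exact Subtype.ext (inv_injective (RootPairing.Equiv.coweightHom_injective P h'))

theorem weylGroupToPerm_ofIdx (P : RootPairing ι ℝ M N) (i : ι) :
    P.weylGroupToPerm (RootPairing.weylGroup.ofIdx P i) = P.reflectionPerm i :=
  RootPairing.Equiv.reflection_indexEquiv P i

theorem ofIdx_mul_self (P : RootPairing ι ℝ M N) (i : ι) :
    RootPairing.weylGroup.ofIdx P i * RootPairing.weylGroup.ofIdx P i = 1 := by
  rw [mul_eq_one_iff_eq_inv]
  exact Subtype.ext (RootPairing.Equiv.reflection_inv P i).symm

theorem coweightAction_coroot (P : RootPairing ι ℝ M N) (w : P.weylGroup) (i : ι) :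
    coweightAction P w (P.coroot i) = P.coroot (P.weylGroupToPerm w i) := by
  have h := RootPairing.Hom.coroot_coweightMap_apply P P i (w⁻¹ : P.weylGroup).1.toHom
  have h2 : P.weylGroupToPerm w i = (P.weylGroupToPerm w⁻¹).symm i := by
    rw [map_inv]
    rfl
  rw [h2]
  exact h

/-- This is w s_α w⁻¹ = s_{wα}, the only relation the exchange argument needs besides s² = 1. -/
theorem conj_ofIdx (P : RootPairing ι ℝ M N) (w : P.weylGroup) (i : ι) :
    w * RootPairing.weylGroup.ofIdx P i =
      RootPairing.weylGroup.ofIdx P (P.weylGroupToPerm w i) * w := by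
  apply coweightAction_injective P
  ext x
  simp only [map_mul, LinearEquiv.mul_apply, coweightAction_ofIdx, map_sub, map_smul,
    coweightAction_coroot, root'_coweightAction]
  simp

variable [Finite ι] {P : RootPairing ι ℝ M N} [P.IsRootSystem] [P.IsCrystallographic]
  [P.IsReduced] (b : P.Base)

-- The exchange condition: when a word makes the simple root `j` negative, some letter is
-- responsible for the change of sign, and multiplying by the reflection in `j` on the right deletes
-- that letter.
omit [P.IsRootSystem] in
include b in
theorem exchange {J : Set ι} (hJ : J ⊆ b.support) {j : ι} (hj : j ∈ b.support) (l : List ι)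
    (hl : ∀ i ∈ l, i ∈ J)
    (hneg : ¬ b.IsPos (P.weylGroupToPerm (l.map (RootPairing.weylGroup.ofIdx P)).prod j)) :
    ∃ l' : List ι, (∀ i ∈ l', i ∈ J) ∧ l'.length + 1 = l.length ∧
      (l.map (RootPairing.weylGroup.ofIdx P)).prod * RootPairing.weylGroup.ofIdx P j =
        (l'.map (RootPairing.weylGroup.ofIdx P)).prod := by
  induction l with
  | nil =>
    refine absurd (RootPairing.Base.isPos_of_mem_support hj) ?_
    simpa using hneg
  | cons i l ih =>
    have hi : i ∈ J := hl i (by simp)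
    have hl' : ∀ k ∈ l, k ∈ J := fun k hk => hl k (by simp [hk])
    by_cases hpos : b.IsPos (P.weylGroupToPerm (l.map (RootPairing.weylGroup.ofIdx P)).prod j)
    · have hk : P.weylGroupToPerm (l.map (RootPairing.weylGroup.ofIdx P)).prod j = i := by
        by_contra hne
        apply hneg
        rw [List.map_cons, List.prod_cons, map_mul, Equiv.Perm.mul_apply, weylGroupToPerm_ofIdx]
        exact hpos.reflectionPerm (hJ hi) hne
      refine ⟨l, hl', by simp, ?_⟩
      rw [List.map_cons, List.prod_cons, mul_assoc, conj_ofIdx, hk, ← mul_assoc, ofIdx_mul_self,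
        one_mul]
    · obtain ⟨l', h1, h2, h3⟩ := ih hl' hpos
      refine ⟨i :: l', ?_, by simp [h2], ?_⟩
      · simp only [List.mem_cons]
        rintro k (rfl | hk)
        exacts [hi, h1 k hk]
      · rw [List.map_cons, List.prod_cons, mul_assoc, h3, List.map_cons, List.prod_cons]

theorem wordLength_le {G : Type*} [Group G] {S : Set G} (l : List G) (hl : ∀ s ∈ l, s ∈ S) :
    wordLength S l.prod ≤ l.length :=
  Nat.sInf_le ⟨l, hl, rfl, rfl⟩

omit [Finite ι] [P.IsRootSystem] [P.IsCrystallographic] [P.IsReduced] in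
theorem inv_prod_ofIdx (l : List ι) :
    ((l.map (RootPairing.weylGroup.ofIdx P)).prod)⁻¹ =
      (l.reverse.map (RootPairing.weylGroup.ofIdx P)).prod := by
  rw [List.prod_inv_reverse, List.map_map, List.map_reverse]
  congr 2
  refine List.map_congr_left fun i _ => ?_
  rw [Function.comp_apply, inv_eq_iff_mul_eq_one, ofIdx_mul_self]

omit [Finite ι] [P.IsRootSystem] [P.IsCrystallographic] [P.IsReduced] in
theorem exists_reduced_word {J : Set ι} {w : P.weylGroup}
    (hw : w ∈ Subgroup.closure (reflectionsIn P J)) :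
    ∃ l : List ι, (∀ i ∈ l, i ∈ J) ∧ (l.map (RootPairing.weylGroup.ofIdx P)).prod = w ∧
      l.length = wordLength (reflectionsIn P J) w := by
  have hne : {n : ℕ | ∃ l : List P.weylGroup, (∀ s ∈ l, s ∈ reflectionsIn P J) ∧ l.prod = w ∧
      l.length = n}.Nonempty := by
    rw [← Subgroup.mem_toSubmonoid, Subgroup.closure_toSubmonoid] at hw
    obtain ⟨l, hl, hprod⟩ := Submonoid.exists_list_of_mem_closure hw
    refine ⟨l.length, l, fun s hs => ?_, hprod, rfl⟩
    rcases hl s hs with h | ⟨i, hi, h⟩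
    · exact h
    · refine ⟨i, hi, ?_⟩
      rw [← inv_inv s, ← h, inv_eq_of_mul_eq_one_left (ofIdx_mul_self P i)]
  obtain ⟨l, hl, hprod, hlen⟩ := Nat.sInf_mem hne
  obtain ⟨l', rfl⟩ : l ∈ Set.range (List.map fun i : J => RootPairing.weylGroup.ofIdx P i) := by
    rw [Set.range_list_map]
    intro s hs
    obtain ⟨i, hi, rfl⟩ := hl s hs
    exact ⟨⟨i, hi⟩, rfl⟩
  refine ⟨l'.map Subtype.val, by simp +contextual, ?_, ?_⟩
  · rw [← hprod, List.map_map]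
    rfl
  · rw [List.length_map, ← List.length_map (as := l')]
    exact hlen

-- If v⁻¹ kept α_j positive, then (s_j v)⁻¹ would make it negative, and the exchange condition
-- applied to a reduced word of s_j v would produce a shorter word for v. So s_j v would be longer
-- than v.
omit [P.IsRootSystem] in
theorem not_isPos_of_isLongest {J : Set ι} (hJ : J ⊆ b.support) {v : P.weylGroup}
    (hv : IsLongest (reflectionsIn P J) v) {j : ι} (hj : j ∈ J) :
    ¬ b.IsPos (P.weylGroupToPerm v⁻¹ j) := by
  intro hpos
  set s := RootPairing.weylGroup.ofIdx P j with hs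
  have hsv : s * v ∈ Subgroup.closure (reflectionsIn P J) :=
    mul_mem (Subgroup.subset_closure ⟨j, hj, rfl⟩) hv.1
  obtain ⟨l, hl, hprod, hlen⟩ := exists_reduced_word hsv
  -- The exchange condition deletes letters on right multiplication, so the word is reversed to
  -- represent the inverse.
  have hrev : (l.reverse.map (RootPairing.weylGroup.ofIdx P)).prod = v⁻¹ * s := by
    rw [← inv_prod_ofIdx, hprod, mul_inv_rev, inv_eq_of_mul_eq_one_left (ofIdx_mul_self P j)]
  have hneg : ¬ b.IsPos
      (P.weylGroupToPerm (l.reverse.map (RootPairing.weylGroup.ofIdx P)).prod j) := by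
    rw [hrev, conj_ofIdx, map_mul, weylGroupToPerm_ofIdx, Equiv.Perm.mul_apply]
    exact fun h => (RootPairing.Base.IsPos.neg_iff_not b _).1 h hpos
  obtain ⟨l', h1, h2, h3⟩ := exchange b hJ (hJ hj) l.reverse (by simpa using hl) hneg
  rw [hrev, mul_assoc, ofIdx_mul_self, mul_one] at h3
  have hv' : (l'.reverse.map (RootPairing.weylGroup.ofIdx P)).prod = v := by
    rw [← inv_prod_ofIdx, ← h3, inv_inv]
  have hle : wordLength (reflectionsIn P J) v ≤ l'.length := by
    have := wordLength_le (S := reflectionsIn P J) (l'.reverse.map (RootPairing.weylGroup.ofIdx P))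
      (by
        intro s hs
        obtain ⟨i, hi, rfl⟩ := List.mem_map.1 hs
        exact ⟨i, h1 i (by simpa using hi), rfl⟩)
    rw [hv'] at this
    simpa using this
  have := hv.2 _ hsv
  rw [List.length_reverse] at h2
  omega

-- Here δ plays the role of the half sum of positive coroots; pairing with it turns positivity of a
-- root into positivity of a number.
include b in
omit [Finite ι] [P.IsRootSystem] [P.IsCrystallographic] [P.IsReduced] in
theorem root'_eq_height {δ : N} (hδ : ∀ i ∈ b.support, P.root' i δ = 1) (i : ι) :
    P.root' i δ = b.height i := by
  obtain ⟨f, -, -, hf⟩ := b.exists_root_eq_sum_int i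
  rw [RootPairing.Base.height_eq_sum hf]
  have h1 : P.root' i δ = P.toLinearMap (P.root i) δ := rfl
  rw [h1, hf]
  simp only [map_sum, map_zsmul, LinearMap.coe_sum, Finset.sum_apply, LinearMap.smul_apply]
  push_cast
  refine Finset.sum_congr rfl fun j hj => ?_
  have h2 : P.toLinearMap (P.root j) δ = 1 := hδ j hj
  rw [h2]
  simp

theorem isLongest_longestElement (P : RootPairing ι ℝ M N) [P.IsRootSystem]
    (S : Set P.weylGroup) : IsLongest S (longestElement S) := by
  have : Finite P.weylGroup := finite_weylGroup P
  exact Classical.epsilon_spec (exists_isLongest _)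

/-- The longest element of a parabolic subgroup moves a vector on which the simple roots are `1`
to the opposite side of every wall of the parabolic subgroup. -/
theorem root'_longestElement_neg {J : Set ι} (hJ : J ⊆ b.support) {δ : N}
    (hδ : ∀ i ∈ b.support, P.root' i δ = 1) {j : ι} (hj : j ∈ J) :
    P.root' j (coweightAction P (longestElement (reflectionsIn P J)) δ) < 0 := by
  have h := not_isPos_of_isLongest b hJ (isLongest_longestElement P _) hj
  rw [RootPairing.Base.isPos_iff] at h
  rw [root'_coweightAction, root'_eq_height b hδ, Int.cast_lt_zero]
  exact lt_of_le_of_ne (not_lt.1 h) (b.height_ne_zero _)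

end Descent

/-! ### Coordinates for a root system of type `D` -/

section Coordinates

variable {n : ℕ}

/-- The simple roots of type `D` as linear forms in the standard coordinates. -/
def simpleForms (n : ℕ) : (Fin (n + 2) → ℝ) →ₗ[ℝ] (Fin (n + 2) → ℝ) :=
  LinearMap.pi (Fin.lastCases (motive := fun _ => (Fin (n + 2) → ℝ) →ₗ[ℝ] ℝ)
    ((LinearMap.proj (Fin.last n).castSucc : (Fin (n + 2) → ℝ) →ₗ[ℝ] ℝ) +
      (LinearMap.proj (Fin.last (n + 1)) : (Fin (n + 2) → ℝ) →ₗ[ℝ] ℝ))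
    fun i => (LinearMap.proj i.castSucc : (Fin (n + 2) → ℝ) →ₗ[ℝ] ℝ) -
      (LinearMap.proj i.succ : (Fin (n + 2) → ℝ) →ₗ[ℝ] ℝ))

@[simp] theorem simpleForms_castSucc (v : Fin (n + 2) → ℝ) (i : Fin (n + 1)) :
    simpleForms n v i.castSucc = v i.castSucc - v i.succ := by
  simp [simpleForms]

@[simp] theorem simpleForms_last (v : Fin (n + 2) → ℝ) :
    simpleForms n v (Fin.last (n + 1)) =
      v (Fin.last n).castSucc + v (Fin.last (n + 1)) := by
  simp [simpleForms]

/-- The chain forms make all coordinates equal, and the fork form then makes twice their common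
value vanish. -/
theorem simpleForms_injective : Function.Injective (simpleForms n) := by
  rw [← LinearMap.ker_eq_bot, LinearMap.ker_eq_bot']
  intro v hv
  have hconst : ∀ i, v i = v 0 := by
    intro i
    induction i using Fin.induction with
    | zero => rfl
    | succ i ih =>
      have := congrFun hv i.castSucc
      rw [simpleForms_castSucc, Pi.zero_apply] at this
      linarith
  have hlast := congrFun hv (Fin.last (n + 1))
  rw [simpleForms_last, Pi.zero_apply, hconst, hconst (Fin.last _)] at hlast
  ext i
  rw [hconst, Pi.zero_apply]
  linarith

/-- The simple coroots of type `D` in the standard coordinates. -/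
def simpleVectors (n : ℕ) (j : Fin (n + 2)) : Fin (n + 2) → ℝ :=
  Fin.lastCases (motive := fun _ => Fin (n + 2) → ℝ)
    (Pi.single (Fin.last n).castSucc 1 + Pi.single (Fin.last (n + 1)) 1)
    (fun j => Pi.single j.castSucc 1 - Pi.single j.succ 1) j

theorem simpleForms_simpleVectors (hn : 2 ≤ n) (i j : Fin (n + 2)) :
    simpleForms n (simpleVectors n j) i = CartanMatrix.D (n + 2) i j := by
  have h2 : ¬ n + 2 ≤ 2 := by omega
  refine Fin.lastCases ?_ (fun i => ?_) i <;> refine Fin.lastCases ?_ (fun j => ?_) j <;>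
    simp only [simpleForms_castSucc, simpleForms_last, simpleVectors, Fin.lastCases_last,
      Fin.lastCases_castSucc, Pi.add_apply, Pi.sub_apply, Pi.single_apply, CartanMatrix.D,
      Matrix.of_apply, h2, if_false, Fin.ext_iff, Fin.val_castSucc, Fin.val_succ, Fin.val_last,
      or_true, and_true]
  · simp
    norm_num
  · have := j.2
    split_ifs <;> first | omega | norm_num
  · have := i.2
    split_ifs <;> first | omega | norm_num
  · have := i.2
    have := j.2
    split_ifs <;> first | omega | norm_num

variable {ι M N : Type*} [AddCommGroup M] [Module ℝ M] [AddCommGroup N] [Module ℝ N]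

/-- `φ` is a system of coordinates in which the simple roots are `x₁ - x₂, …, x_{ℓ-1} - x_ℓ` and
`x_{ℓ-1} + x_ℓ`, and the simple coroots are the corresponding vectors. -/
structure IsStandard {P : RootPairing ι ℝ M N} (b : P.Base) (e : Fin (n + 2) ≃ b.support)
    (φ : N ≃ₗ[ℝ] (Fin (n + 2) → ℝ)) : Prop where
  root : ∀ i x, P.root' (e i) x = simpleForms n (φ x) i
  coroot : ∀ i, φ (P.coroot (e i)) = simpleVectors n i

theorem eq_zero_of_root'_eq_zero {P : RootPairing ι ℝ M N} [P.IsRootSystem] (b : P.Base) {x : N}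
    (hx : ∀ i ∈ b.support, P.root' i x = 0) : x = 0 := by
  have h : P.toLinearMap.flip x = 0 := by
    refine b.toWeightBasis.ext fun i => ?_
    rw [RootPairing.Base.toWeightBasis_apply]
    exact hx i i.2
  exact P.flip.toPerfPair.injective (h.trans (map_zero _).symm)

/-- Both the simple roots on `N` and the standard forms on ℝ^(n+2) are complete linear coordinates;
matching them defines `φ`. The coroots then go to the right vectors because both sides have the same
Cartan matrix. -/
theorem exists_isStandard {P : RootPairing ι ℝ M N} [P.IsRootSystem] [P.IsCrystallographic]
    (b : P.Base) (hn : 2 ≤ n) (e : Fin (n + 2) ≃ b.support) (hD : IsTypeD b e) :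
    ∃ φ, IsStandard b e φ := by
  let A : N →ₗ[ℝ] (Fin (n + 2) → ℝ) := LinearMap.pi fun i => P.root' (e i)
  have hA : Function.Injective A := by
    rw [← LinearMap.ker_eq_bot, LinearMap.ker_eq_bot']
    intro x hx
    refine eq_zero_of_root'_eq_zero b fun i hi => ?_
    have := congrFun hx (e.symm ⟨i, hi⟩)
    simpa [A] using this
  have : Module.Finite ℝ N := Module.Finite.of_basis b.toCoweightBasis
  have hdim : Module.finrank ℝ N = Module.finrank ℝ (Fin (n + 2) → ℝ) := by
    rw [Module.finrank_eq_card_basis (b.toCoweightBasis.reindex e.symm),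
      Module.finrank_fin_fun, Fintype.card_fin]
  let B := LinearEquiv.ofInjectiveEndo (simpleForms n) simpleForms_injective
  let φ := (LinearEquiv.ofInjectiveOfFinrankEq A hA hdim).trans B.symm
  have hφ : ∀ x, simpleForms n (φ x) = A x := fun x => B.apply_symm_apply (A x)
  refine ⟨φ, fun i x => ?_, fun j => ?_⟩
  · rw [hφ]
    rfl
  · apply simpleForms_injective
    ext i
    rw [hφ, simpleForms_simpleVectors hn, ← hD]
    have := RootPairing.Base.algebraMap_cartanMatrixIn_apply ℤ b (e i) (e j)
    exact this.symm

/-- The symmetry exchanging the two fork nodes lets the results on α_ℓ apply to α_{ℓ-1}. -/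
theorem IsTypeD.swap {P : RootPairing ι ℝ M N} [P.IsCrystallographic]
    {b : P.Base} (hn : 2 ≤ n) {e : Fin (n + 2) ≃ b.support} (hD : IsTypeD b e) :
    IsTypeD b ((Equiv.swap (Fin.last n).castSucc (Fin.last (n + 1))).trans e) := by
  intro i j
  rw [Equiv.trans_apply, Equiv.trans_apply, hD]
  have key : ∀ i : Fin (n + 2), ∃ k : ℕ,
      (Equiv.swap (Fin.last n).castSucc (Fin.last (n + 1)) i).val = k ∧
        (i.val < n ∧ k = i.val ∨ i.val = n ∧ k = n + 1 ∨ i.val = n + 1 ∧ k = n) := by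
    intro i
    refine ⟨_, rfl, ?_⟩
    have := i.2
    rw [Equiv.swap_apply_def]
    simp only [Fin.ext_iff, Fin.val_castSucc, Fin.val_last, apply_ite Fin.val]
    split_ifs <;> omega
  obtain ⟨k, hk, hik⟩ := key i
  obtain ⟨m, hm, hjm⟩ := key j
  have h2 : ¬ n + 2 ≤ 2 := by omega
  simp only [CartanMatrix.D, Matrix.of_apply, h2, if_false, Fin.ext_iff, hk, hm]
  clear hk hm key
  split_ifs <;> omega

end Coordinates

/-! ### Signed permutations -/

section SignedPermutations

variable {n : ℕ}

theorem perm_eq_one_of_strictMono {m : ℕ} {σ : Equiv.Perm (Fin m)} (h : StrictMono σ) :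
    σ = 1 := by
  apply Equiv.ext
  refine congrFun ((StrictMono.range_inj h strictMono_id).1 ?_)
  rw [σ.surjective.range_eq, Set.range_id]

theorem perm_eq_rev_of_strictAnti {m : ℕ} {σ : Equiv.Perm (Fin m)} (h : StrictAnti σ) :
    σ = Fin.revPerm := by
  have : σ * Fin.revPerm = 1 := perm_eq_one_of_strictMono fun i j hij =>
    h (Fin.rev_lt_rev.2 hij)
  rw [mul_eq_one_iff_eq_inv] at this
  rw [this]
  ext i
  rfl

/-- A signed permutation of `(n + 1, …, 1, 0)` that is antidominant, except perhaps at the first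
simple root when it fixes the first coordinate up to sign. -/
theorem signedPerm_of_antidominant (hn : 1 ≤ n) {σ : Equiv.Perm (Fin (n + 2))}
    {ε : Fin (n + 2) → ℤˣ} {y : Fin (n + 2) → ℝ}
    (hy : ∀ k, y k = ((ε k : ℤ) : ℝ) * ((n : ℝ) + 1 - (σ k).val))
    (hchain : ∀ i : Fin (n + 1), i ≠ 0 → simpleForms n y i.castSucc < 0)
    (hfork : simpleForms n y (Fin.last (n + 1)) < 0)
    (h0 : σ 0 = 0 ∨ simpleForms n y 0 < 0) :
    σ = 1 ∧ (∀ i : Fin (n + 1), i ≠ 0 → ε i.castSucc = -1) ∧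
      (simpleForms n y 0 < 0 → ε 0 = -1) := by
  have hlast : Fin.last n ≠ 0 := fun h => by
    have := congrArg Fin.val h
    simp at this
    omega
  simp only [simpleForms_castSucc, sub_neg] at hchain
  rw [simpleForms_last] at hfork
  have hzero : simpleForms n y 0 = y 0 - y 1 := simpleForms_castSucc y 0
  rw [hzero, sub_neg] at h0 ⊢
  -- The last two coordinates satisfy y < y' and y + y' < 0, so y < 0; the chain inequalities carry
  -- negativity backwards from there.
  have hneg : ∀ i : Fin (n + 1), i ≠ 0 → y i.castSucc < 0 := by
    intro i
    induction i using Fin.reverseInduction with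
    | last =>
      intro _
      have := hchain _ hlast
      rw [Fin.succ_last] at this
      linarith
    | cast i ih =>
      intro hi
      have := hchain _ hi
      rw [Fin.succ_castSucc] at this
      exact this.trans (ih (Fin.succ_ne_zero i))
  have hneg0 : y 0 < y 1 → y 0 < 0 := by
    intro h
    have h1 : (1 : Fin (n + 2)) = (⟨1, by omega⟩ : Fin (n + 1)).castSucc := rfl
    rw [h1] at h
    refine h.trans (hneg _ ?_)
    simp [Fin.ext_iff]
  have hbound : ∀ k : Fin (n + 2), 0 ≤ (n : ℝ) + 1 - (σ k).val := by
    intro k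
    have : (((σ k).val : ℕ) : ℝ) ≤ ((n + 1 : ℕ) : ℝ) := Nat.cast_le.2 (by omega)
    push_cast at this
    linarith
  have hsign : ∀ k, y k < 0 → ε k = -1 := by
    intro k hk
    rcases Int.units_eq_one_or (ε k) with h | h
    · rw [hy, h] at hk
      have := hbound k
      push_cast at hk
      linarith
    · exact h
  -- From a < b and a + b < 0 follows |b| < |a|; since the absolute values are n + 1 - σ(k), σ
  -- increases at this step.
  have hlt : ∀ i : Fin (n + 1), y i.castSucc < y i.succ → y i.castSucc + y i.succ < 0 →
      σ i.castSucc < σ i.succ := by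
    intro i h1 h2
    have h3 := hsign i.castSucc (by linarith)
    rw [hy, hy, h3] at h1 h2
    rw [Fin.lt_def, ← Nat.cast_lt (α := ℝ)]
    rcases Int.units_eq_one_or (ε i.succ) with h | h <;> rw [h] at h1 h2 <;>
      push_cast at h1 h2 <;> linarith
  have hsum : ∀ i : Fin (n + 1), y i.castSucc < 0 → y i.castSucc + y i.succ < 0 := by
    intro i hi
    induction i using Fin.lastCases with
    | last => rw [Fin.succ_last]; exact hfork
    | cast i =>
      rw [Fin.succ_castSucc]
      have := hneg _ (Fin.succ_ne_zero i)
      linarith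
  refine ⟨?_, fun i hi => hsign _ (hneg i hi), fun h => hsign _ (hneg0 h)⟩
  apply perm_eq_one_of_strictMono
  rw [Fin.strictMono_iff_lt_succ]
  intro i
  by_cases hi : i = 0
  · subst hi
    rcases h0 with h0 | h0
    · rw [Fin.castSucc_zero, h0]
      refine Fin.pos_of_ne_zero fun h => ?_
      rw [← h0] at h
      exact absurd (σ.injective h) (Fin.succ_ne_zero _)
    · exact hlt _ h0 (hsum _ (hneg0 h0))
  · exact hlt _ (hchain i hi) (hsum i (hneg i hi))

/-! ### Weyl group elements as signed permutations -/

variable {ι M N : Type*} [AddCommGroup M] [Module ℝ M] [AddCommGroup N] [Module ℝ N]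

/-- `w` acts in the coordinates `φ` by the signed permutation `(w x)_k = ε_k x_{σ k}`. -/
def ActsBy {P : RootPairing ι ℝ M N} (φ : N ≃ₗ[ℝ] (Fin (n + 2) → ℝ)) (w : P.weylGroup)
    (σ : Equiv.Perm (Fin (n + 2))) (ε : Fin (n + 2) → ℤˣ) : Prop :=
  ∀ x k, φ (coweightAction P w x) k = ((ε k : ℤ) : ℝ) * φ x (σ k)

variable {P : RootPairing ι ℝ M N} {φ : N ≃ₗ[ℝ] (Fin (n + 2) → ℝ)}

theorem actsBy_one : ActsBy φ (1 : P.weylGroup) 1 1 := fun x k => by simp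

theorem ActsBy.mul {v w : P.weylGroup} {σ τ : Equiv.Perm (Fin (n + 2))}
    {ε η : Fin (n + 2) → ℤˣ} (hv : ActsBy φ v σ ε) (hw : ActsBy φ w τ η) :
    ActsBy φ (v * w) (τ * σ) (fun k => ε k * η (σ k)) := fun x k => by
  rw [map_mul, LinearEquiv.mul_apply, hv, hw]
  push_cast
  rw [mul_assoc]
  rfl

theorem ActsBy.unique {v w : P.weylGroup} {σ : Equiv.Perm (Fin (n + 2))}
    {ε : Fin (n + 2) → ℤˣ} (hv : ActsBy φ v σ ε) (hw : ActsBy φ w σ ε) : v = w := by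
  apply coweightAction_injective P
  ext x
  apply φ.injective
  ext k
  rw [hv, hw]

/-- Induction on a word in the generators; `C` is any property of signed permutations stable under
products, such as evenness of the signs. -/
theorem exists_actsBy_of_mem_closure
    (C : Equiv.Perm (Fin (n + 2)) → (Fin (n + 2) → ℤˣ) → Prop) (hone : C 1 1)
    (hmul : ∀ σ τ ε η, C σ ε → C τ η → C (τ * σ) (fun k => ε k * η (σ k))) {J : Set ι}
    (hgen : ∀ i ∈ J, ∃ σ ε, ActsBy φ (RootPairing.weylGroup.ofIdx P i) σ ε ∧ C σ ε)
    {w : P.weylGroup} (hw : w ∈ Subgroup.closure (reflectionsIn P J)) :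
    ∃ σ ε, ActsBy φ w σ ε ∧ C σ ε := by
  obtain ⟨l, hl, rfl, -⟩ := exists_reduced_word hw
  clear hw
  induction l with
  | nil => exact ⟨1, 1, actsBy_one, hone⟩
  | cons i l ih =>
    obtain ⟨σ, ε, h1, h2⟩ := hgen i (hl i (by simp))
    obtain ⟨τ, η, h3, h4⟩ := ih fun j hj => hl j (by simp [hj])
    rw [List.map_cons, List.prod_cons]
    exact ⟨_, _, h1.mul h3, hmul _ _ _ _ h2 h4⟩

variable {b : P.Base} {e : Fin (n + 2) ≃ b.support}

theorem IsStandard.actsBy_castSucc (h : IsStandard b e φ) (i : Fin (n + 1)) :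
    ActsBy φ (RootPairing.weylGroup.ofIdx P (e i.castSucc))
      (Equiv.swap i.castSucc i.succ) 1 := fun x k => by
  have hne : i.castSucc ≠ i.succ := Fin.castSucc_lt_succ.ne
  rw [coweightAction_ofIdx, map_sub, map_smul, h.root, h.coroot, simpleForms_castSucc]
  simp only [simpleVectors, Fin.lastCases_castSucc, Pi.sub_apply, Pi.smul_apply, Pi.single_apply,
    smul_eq_mul, Pi.one_apply, Units.val_one, Int.cast_one, one_mul, Equiv.swap_apply_def]
  split_ifs with h1 h2 h2
  · exact absurd (h1.symm.trans h2) hne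
  · subst h1; ring
  · subst h2; ring
  · ring

theorem IsStandard.actsBy_last (h : IsStandard b e φ) :
    ActsBy φ (RootPairing.weylGroup.ofIdx P (e (Fin.last (n + 1))))
      (Equiv.swap (Fin.last n).castSucc (Fin.last (n + 1)))
      (fun k => if k = (Fin.last n).castSucc ∨ k = Fin.last (n + 1) then -1 else 1) :=
    fun x k => by
  have hne : (Fin.last n).castSucc ≠ Fin.last (n + 1) := (Fin.castSucc_lt_last _).ne
  rw [coweightAction_ofIdx, map_sub, map_smul, h.root, h.coroot, simpleForms_last]
  simp only [simpleVectors, Fin.lastCases_last, Pi.sub_apply, Pi.add_apply, Pi.smul_apply,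
    Pi.single_apply, smul_eq_mul, Equiv.swap_apply_def]
  by_cases h1 : k = (Fin.last n).castSucc
  · subst h1
    simp [hne]
  · by_cases h2 : k = Fin.last (n + 1)
    · subst h2
      simp [hne.symm]
    · simp [h1, h2]

theorem mul_prod_signs (σ : Equiv.Perm (Fin (n + 2))) {ε η : Fin (n + 2) → ℤˣ}
    (hε : ∏ k, ε k = 1) (hη : ∏ k, η k = 1) : ∏ k, ε k * η (σ k) = 1 := by
  rw [Finset.prod_mul_distrib, hε, Equiv.prod_comp σ η, hη, one_mul]

theorem prod_fork_signs :
    ∏ k : Fin (n + 2), (if k = (Fin.last n).castSucc ∨ k = Fin.last (n + 1) then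
      (-1 : ℤˣ) else 1) = 1 := by
  rw [Fin.prod_univ_castSucc, Fin.prod_univ_castSucc, Finset.prod_eq_one]
  · simp
  · intro i _
    rw [if_neg]
    rintro (h | h) <;> · have := congrArg Fin.val h; simp at this; omega

theorem IsStandard.exists_actsBy_even (h : IsStandard b e φ) {w : P.weylGroup}
    (hw : w ∈ Subgroup.closure (reflectionsIn P {i | i ∈ b.support})) :
    ∃ σ ε, ActsBy φ w σ ε ∧ ∏ k, ε k = 1 := by
  refine exists_actsBy_of_mem_closure (fun _ ε => ∏ k, ε k = 1) (by simp)
    (fun σ _ _ _ => mul_prod_signs σ) (fun i hi => ?_) hw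
  obtain ⟨k, hk⟩ := e.surjective ⟨i, hi⟩
  obtain rfl : (e k : ι) = i := congrArg Subtype.val hk
  refine Fin.lastCases ?_ (fun k => ?_) k
  · exact ⟨_, _, h.actsBy_last, prod_fork_signs⟩
  · exact ⟨_, _, h.actsBy_castSucc k, by simp⟩

theorem IsStandard.exists_actsBy_fix (h : IsStandard b e φ) (hn : 1 ≤ n) {w : P.weylGroup}
    (hw : w ∈ Subgroup.closure (reflectionsIn P {i | i ∈ b.support ∧ i ≠ e 0})) :
    ∃ σ ε, ActsBy φ w σ ε ∧ ∏ k, ε k = 1 ∧ σ 0 = 0 ∧ ε 0 = 1 := by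
  refine exists_actsBy_of_mem_closure (fun σ ε => ∏ k, ε k = 1 ∧ σ 0 = 0 ∧ ε 0 = 1) (by simp)
    ?_ (fun i hi => ?_) hw
  · rintro σ τ ε η ⟨h1, h2, h3⟩ ⟨h4, h5, h6⟩
    exact ⟨mul_prod_signs σ h1 h4, by simp [h2, h5], by simp [h2, h3, h6]⟩
  · obtain ⟨k, hk⟩ := e.surjective ⟨i, hi.1⟩
    obtain rfl : (e k : ι) = i := congrArg Subtype.val hk
    have hk0 : k ≠ 0 := fun hk => hi.2 (by rw [hk])
    clear hk hi
    revert hk0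
    refine Fin.lastCases ?_ (fun k => ?_) k <;> intro hk0
    · refine ⟨_, _, h.actsBy_last, prod_fork_signs, ?_, ?_⟩
      · apply Equiv.swap_apply_of_ne_of_ne <;> · simp [Fin.ext_iff]; try omega
      · rw [if_neg]
        simp [Fin.ext_iff]; omega
    · refine ⟨_, _, h.actsBy_castSucc k, by simp, ?_, rfl⟩
      exact Equiv.swap_apply_of_ne_of_ne hk0.symm (Fin.succ_ne_zero k).symm

theorem IsStandard.exists_actsBy_perm (h : IsStandard b e φ) {w : P.weylGroup}
    (hw : w ∈ Subgroup.closure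
      (reflectionsIn P {i | i ∈ b.support ∧ i ≠ e (Fin.last (n + 1))})) :
    ∃ σ ε, ActsBy φ w σ ε ∧ ε = 1 := by
  refine exists_actsBy_of_mem_closure (fun _ ε => ε = 1) rfl ?_ (fun i hi => ?_) hw
  · rintro σ τ ε η rfl rfl
    ext k
    simp
  · obtain ⟨k, hk⟩ := e.surjective ⟨i, hi.1⟩
    obtain rfl : (e k : ι) = i := congrArg Subtype.val hk
    have hk0 : k ≠ Fin.last (n + 1) := fun hk => hi.2 (by rw [hk])
    obtain ⟨k, rfl⟩ := Fin.eq_castSucc_of_ne_last hk0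
    exact ⟨_, _, h.actsBy_castSucc k, rfl⟩

/-- The vector on which all simple roots take the value `1`. -/
def weylVector (φ : N ≃ₗ[ℝ] (Fin (n + 2) → ℝ)) : N :=
  φ.symm fun k => (n : ℝ) + 1 - k.val

theorem IsStandard.root'_weylVector (h : IsStandard b e φ) (i : ι) (hi : i ∈ b.support) :
    P.root' i (weylVector φ) = 1 := by
  obtain ⟨k, hk⟩ := e.surjective ⟨i, hi⟩
  obtain rfl : (e k : ι) = i := congrArg Subtype.val hk
  rw [h.root, weylVector, LinearEquiv.apply_symm_apply]
  refine Fin.lastCases ?_ (fun k => ?_) k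
  · simp
  · simp

theorem ActsBy.apply_weylVector {w : P.weylGroup} {σ : Equiv.Perm (Fin (n + 2))}
    {ε : Fin (n + 2) → ℤˣ} (hw : ActsBy φ w σ ε) (k : Fin (n + 2)) :
    φ (coweightAction P w (weylVector φ)) k =
      ((ε k : ℤ) : ℝ) * ((n : ℝ) + 1 - (σ k).val) := by
  rw [hw, weylVector, LinearEquiv.apply_symm_apply]

/-! ### Longest elements and ω_j as signed permutations -/

variable [Finite ι] [P.IsRootSystem] [P.IsCrystallographic] [P.IsReduced]

theorem IsStandard.simpleForms_longestElement_neg (h : IsStandard b e φ) {J : Set ι}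
    (hJ : J ⊆ b.support) (k : Fin (n + 2)) (hk : (e k : ι) ∈ J) :
    simpleForms n (φ (coweightAction P (longestElement (reflectionsIn P J)) (weylVector φ))) k
      < 0 := by
  rw [← h.root]
  exact root'_longestElement_neg b hJ h.root'_weylVector hk

omit [Finite ι] [P.IsRootSystem] [P.IsCrystallographic] [P.IsReduced] in
theorem coe_ne_coe {k l : Fin (n + 2)} (h : k ≠ l) : (e k : ι) ≠ e l :=
  fun h' => h (e.injective (Subtype.ext h'))

/-- The last coordinate of the Weyl vector is 0, so antidominance does not see its sign. Evenness
does: the other `n + 1` signs are -1 and `n + 1` is even. -/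
theorem IsStandard.actsBy_longest (h : IsStandard b e φ) (hn : Odd n) :
    ActsBy φ (longestElement (reflectionsIn P {i | i ∈ b.support})) 1
      (fun k => if k = Fin.last (n + 1) then 1 else -1) := by
  obtain ⟨σ, ε, hw, hε⟩ := h.exists_actsBy_even (isLongest_longestElement P _).1
  have hneg := fun k => h.simpleForms_longestElement_neg (J := {i | i ∈ b.support})
    (fun _ hi => hi) k (e k).2
  obtain ⟨rfl, h1, h2⟩ := signedPerm_of_antidominant hn.pos hw.apply_weylVector
    (fun i _ => hneg _) (hneg _) (Or.inr (hneg _))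
  have h3 : ∀ i : Fin (n + 1), ε i.castSucc = -1 := by
    intro i
    by_cases hi : i = 0
    · subst hi
      exact h2 (hneg _)
    · exact h1 i hi
  convert! hw using 1
  ext k : 1
  refine Fin.lastCases ?_ (fun i => ?_) k
  · rw [Fin.prod_univ_castSucc, Finset.prod_congr rfl fun i _ => h3 i] at hε
    simpa [hn.add_one.neg_one_pow, eq_comm] using hε
  · rw [if_neg (Fin.castSucc_lt_last i).ne, h3]

/-- The parabolic subgroup fixes the first coordinate. The `n` middle signs are -1 with `n` odd, so
evenness makes the last sign -1 as well. -/
theorem IsStandard.actsBy_longest_ne_zero (h : IsStandard b e φ) (hn : Odd n) :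
    ActsBy φ (longestElement (reflectionsIn P {i | i ∈ b.support ∧ i ≠ e 0})) 1
      (fun k => if k = 0 then 1 else -1) := by
  obtain ⟨σ, ε, hw, hε, hσ, h0⟩ := h.exists_actsBy_fix hn.pos (isLongest_longestElement P _).1
  have hneg := fun (k : Fin (n + 2)) (hk : k ≠ 0) => h.simpleForms_longestElement_neg
    (J := {i | i ∈ b.support ∧ i ≠ e 0}) (fun _ hi => hi.1) k ⟨(e k).2, coe_ne_coe hk⟩
  obtain ⟨rfl, h1, -⟩ := signedPerm_of_antidominant hn.pos hw.apply_weylVector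
    (fun i hi => hneg _ (by simpa using hi)) (hneg _ (by simp [Fin.ext_iff])) (Or.inl hσ)
  convert! hw using 1
  ext k : 1
  refine Fin.lastCases ?_ (fun i => ?_) k
  · rw [Fin.prod_univ_castSucc, Fin.prod_univ_succ,
      Finset.prod_congr rfl fun i _ => h1 _ (Fin.succ_ne_zero i)] at hε
    rw [if_neg (by simp [Fin.ext_iff])]
    simpa [hn.neg_one_pow, h0, neg_eq_iff_eq_neg] using hε.symm
  · by_cases hi : i = 0
    · subst hi
      simpa using h0.symm
    · rw [if_neg (by simpa using hi), h1 i hi]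

/-- Without the fork root α_ℓ only permutations remain, and antidominance makes the permutation
order reversing. -/
theorem IsStandard.actsBy_longest_ne_last (h : IsStandard b e φ) :
    ActsBy φ (longestElement (reflectionsIn P {i | i ∈ b.support ∧ i ≠ e (Fin.last (n + 1))}))
      Fin.revPerm 1 := by
  obtain ⟨σ, ε, hw, rfl⟩ := h.exists_actsBy_perm (isLongest_longestElement P _).1
  have hneg := fun (k : Fin (n + 1)) => h.simpleForms_longestElement_neg
    (J := {i | i ∈ b.support ∧ i ≠ e (Fin.last (n + 1))}) (fun _ hi => hi.1) k.castSucc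
    ⟨(e _).2, coe_ne_coe (Fin.castSucc_lt_last k).ne⟩
  have hσ : σ = Fin.revPerm := by
    apply perm_eq_rev_of_strictAnti
    rw [Fin.strictAnti_iff_succ_lt]
    intro i
    have := hneg i
    rw [simpleForms_castSucc, hw.apply_weylVector, hw.apply_weylVector] at this
    rw [Fin.lt_def, ← Nat.cast_lt (α := ℝ)]
    simp only [Pi.one_apply, Units.val_one, Int.cast_one, one_mul] at this
    linarith
  rwa [← hσ]

theorem IsStandard.actsBy_omega_zero (h : IsStandard b e φ) (hn : Odd n) :
    ActsBy φ (omega b (e 0)) 1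
      (fun k => if k = 0 ∨ k = Fin.last (n + 1) then -1 else 1) := by
  convert! (h.actsBy_longest_ne_zero hn).mul (h.actsBy_longest hn) using 1
  ext k : 1
  have h0 : (0 : Fin (n + 2)) ≠ Fin.last (n + 1) := by simp [Fin.ext_iff]
  by_cases hk : k = 0
  · subst hk
    simp [h0]
  · by_cases hk' : k = Fin.last (n + 1) <;> simp [hk, hk']

theorem IsStandard.actsBy_omega_last (h : IsStandard b e φ) (hn : Odd n) :
    ActsBy φ (omega b (e (Fin.last (n + 1)))) Fin.revPerm
      (fun k => if k = 0 then 1 else -1) := by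
  convert! h.actsBy_longest_ne_last.mul (h.actsBy_longest hn) using 1
  ext k : 1
  simp [Fin.rev_eq_iff]

end SignedPermutations

/-! ### Reduction to configurations in `ZMod (2 * q)` -/

section Reduction

variable {n : ℕ}

theorem exists_perm_apply_eq {α : Type*} [DecidableEq α] {a b k l : α} (hab : a ≠ b)
    (hkl : k ≠ l) : ∃ σ : Equiv.Perm α, σ a = k ∧ σ b = l := by
  have hne : k ≠ Equiv.swap a k b := by
    intro h
    rw [← Equiv.swap_apply_left a k] at h
    exact hab ((Equiv.swap a k).injective (by simpa using h))
  refine ⟨Equiv.swap (Equiv.swap a k b) l * Equiv.swap a k, ?_, ?_⟩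
  · rw [Equiv.Perm.mul_apply, Equiv.swap_apply_left, Equiv.swap_apply_of_ne_of_ne hne hkl]
  · rw [Equiv.Perm.mul_apply, Equiv.swap_apply_left]

variable {ι M N : Type*} [AddCommGroup M] [Module ℝ M] [AddCommGroup N] [Module ℝ N]
  {P : RootPairing ι ℝ M N} {b : P.Base} {e : Fin (n + 2) ≃ b.support}
  {φ : N ≃ₗ[ℝ] (Fin (n + 2) → ℝ)}

theorem IsStandard.exists_actsBy_of_perm (h : IsStandard b e φ) (σ : Equiv.Perm (Fin (n + 2))) :
    ∃ w : P.weylGroup, ActsBy φ w σ 1 := by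
  have hσ : σ ∈ Submonoid.closure
      (Set.range fun i : Fin (n + 1) => Equiv.swap i.castSucc i.succ) := by
    rw [Equiv.Perm.mclosure_swap_castSucc_succ]
    trivial
  induction hσ using Submonoid.closure_induction with
  | mem _ hs =>
    obtain ⟨i, rfl⟩ := hs
    exact ⟨_, h.actsBy_castSucc i⟩
  | one => exact ⟨1, actsBy_one⟩
  | mul σ τ _ _ h1 h2 =>
    obtain ⟨v, hv⟩ := h1
    obtain ⟨w, hw⟩ := h2
    -- `ActsBy` is contravariant in the permutation, so the factors change order.
    refine ⟨w * v, ?_⟩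
    convert! hw.mul hv using 1

/-- All coordinate permutations come from the Weyl group, so the first simple root can be moved to
any ordered pair of coordinates. -/
theorem IsStandard.exists_root_sub (h : IsStandard b e φ) {k l : Fin (n + 2)} (hkl : k ≠ l) :
    ∃ i, ∀ x, P.root' i x = φ x k - φ x l := by
  have h01 : (Fin.castSucc 0 : Fin (n + 2)) ≠ Fin.succ 0 := Fin.castSucc_lt_succ.ne
  obtain ⟨σ, h1, h2⟩ := exists_perm_apply_eq h01 hkl
  obtain ⟨w, hw⟩ := h.exists_actsBy_of_perm σ
  refine ⟨P.weylGroupToPerm w⁻¹ (e (Fin.castSucc 0)), fun x => ?_⟩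
  rw [← root'_coweightAction, h.root, simpleForms_castSucc, hw, hw, h1, h2]
  simp

theorem IsStandard.exists_root_add (h : IsStandard b e φ) {k l : Fin (n + 2)} (hkl : k ≠ l) :
    ∃ i, ∀ x, P.root' i x = φ x k + φ x l := by
  have h01 : (Fin.last n).castSucc ≠ Fin.last (n + 1) := (Fin.castSucc_lt_last _).ne
  obtain ⟨σ, h1, h2⟩ := exists_perm_apply_eq h01 hkl
  obtain ⟨w, hw⟩ := h.exists_actsBy_of_perm σ
  refine ⟨P.weylGroupToPerm w⁻¹ (e (Fin.last (n + 1))), fun x => ?_⟩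
  rw [← root'_coweightAction, h.root, simpleForms_last, hw, hw, h1, h2]
  simp

/-- Every root is reached from simple roots by simple reflections and negation, and signed
permutations preserve the shape ±x_k ± x_l. -/
theorem IsStandard.exists_root'_eq [Finite ι] [P.IsCrystallographic] [P.IsReduced]
    (h : IsStandard b e φ) (i : ι) :
    ∃ k l : Fin (n + 2), k ≠ l ∧ ∃ s t : ℤˣ, ∀ x, P.root' i x =
      ((s : ℤ) : ℝ) * φ x k + ((t : ℤ) : ℝ) * φ x l := by
  have hrefl : ∀ i j x, P.root' (P.reflectionPerm j i) x =
      P.root' i (coweightAction P (RootPairing.weylGroup.ofIdx P j) x) := by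
    intro i j x
    rw [root'_coweightAction, inv_eq_of_mul_eq_one_left (ofIdx_mul_self P j),
      weylGroupToPerm_ofIdx]
  refine b.induction_reflect i (p := fun i => ∃ k l : Fin (n + 2), k ≠ l ∧ ∃ s t : ℤˣ,
    ∀ x, P.root' i x = ((s : ℤ) : ℝ) * φ x k + ((t : ℤ) : ℝ) * φ x l) ?_ ?_ ?_
  · rintro i ⟨k, l, hkl, s, t, hst⟩
    refine ⟨k, l, hkl, -s, -t, fun x => ?_⟩
    have : P.root' (P.reflectionPerm i i) x = - P.root' i x := by
      have h1 : P.root' (P.reflectionPerm i i) x =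
        P.toLinearMap (P.root (P.reflectionPerm i i)) x := rfl
      rw [h1, RootPairing.root_reflectionPerm, RootPairing.reflection_apply_self, map_neg]
      rfl
    rw [this, hst]
    push_cast
    ring
  · intro i hi
    obtain ⟨k, hk⟩ := e.surjective ⟨i, hi⟩
    obtain rfl : (e k : ι) = i := congrArg Subtype.val hk
    refine Fin.lastCases ?_ (fun k => ?_) k
    · exact ⟨_, _, (Fin.castSucc_lt_last (Fin.last n)).ne, 1, 1, fun x => by
        rw [h.root, simpleForms_last]; simp⟩
    · exact ⟨_, _, (Fin.castSucc_lt_succ (i := k)).ne, 1, -1, fun x => by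
        rw [h.root, simpleForms_castSucc]; simp [sub_eq_add_neg]⟩
  · rintro i j ⟨k, l, hkl, s, t, hst⟩ hj
    have hsimple : ∃ σ ε, ActsBy φ (RootPairing.weylGroup.ofIdx P j) σ ε := by
      obtain ⟨m, hm⟩ := e.surjective ⟨j, hj⟩
      obtain rfl : (e m : ι) = j := congrArg Subtype.val hm
      refine Fin.lastCases ?_ (fun m => ?_) m
      · exact ⟨_, _, h.actsBy_last⟩
      · exact ⟨_, _, h.actsBy_castSucc m⟩
    obtain ⟨σ, ε, hσ⟩ := hsimple
    refine ⟨σ k, σ l, fun hkl' => hkl (σ.injective hkl'), s * ε k, t * ε l, fun x => ?_⟩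
    rw [hrefl, hst, hσ, hσ]
    push_cast
    ring

/-- Twice a coordinate is the sum of the roots x_k - x_l and x_k + x_l. -/
theorem IsStandard.exists_int_eq_two_mul (h : IsStandard b e φ) (x : coweightLattice P)
    (k : Fin (n + 2)) : ∃ m : ℤ, (m : ℝ) = 2 * φ (x : N) k := by
  obtain ⟨l, hl⟩ := exists_ne k
  obtain ⟨i, hi⟩ := h.exists_root_sub hl.symm
  obtain ⟨j, hj⟩ := h.exists_root_add hl.symm
  obtain ⟨c, hc⟩ := x.2 i
  obtain ⟨d, hd⟩ := x.2 j
  refine ⟨c + d, ?_⟩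
  push_cast
  rw [← hc, ← hd, hi, hj]
  ring

/-- Twice the standard coordinates of a point of the coweight lattice. -/
noncomputable def doubled (h : IsStandard b e φ) : coweightLattice P →+ (Fin (n + 2) → ℤ) where
  toFun x k := (h.exists_int_eq_two_mul x k).choose
  map_zero' := by
    ext k
    have := (h.exists_int_eq_two_mul 0 k).choose_spec
    exact_mod_cast this.trans (by simp : _ = (0 : ℝ))
  map_add' x y := by
    ext k
    have h1 := (h.exists_int_eq_two_mul x k).choose_spec
    have h2 := (h.exists_int_eq_two_mul y k).choose_spec
    have h3 := (h.exists_int_eq_two_mul (x + y) k).choose_spec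
    replace h3 := h3.trans ((by simp [mul_add] :
      _ = 2 * φ (x : N) k + 2 * φ (y : N) k).trans (congrArg₂ (· + ·) h1 h2).symm)
    exact_mod_cast h3

theorem doubled_spec (h : IsStandard b e φ) (x : coweightLattice P) (k : Fin (n + 2)) :
    (doubled h x k : ℝ) = 2 * φ (x : N) k :=
  (h.exists_int_eq_two_mul x k).choose_spec

theorem doubled_injective (h : IsStandard b e φ) : Function.Injective (doubled h) := by
  intro x y hxy
  apply Subtype.ext
  apply φ.injective
  ext k
  have h1 := doubled_spec h x k
  have h2 := doubled_spec h y k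
  rw [hxy] at h1
  linarith

theorem two_dvd_doubled_sub (h : IsStandard b e φ) (x : coweightLattice P)
    (k l : Fin (n + 2)) : (2 : ℤ) ∣ doubled h x k - doubled h x l := by
  by_cases hkl : k = l
  · simp [hkl]
  obtain ⟨i, hi⟩ := h.exists_root_sub hkl
  obtain ⟨c, hc⟩ := x.2 i
  refine ⟨c, ?_⟩
  rw [hi] at hc
  have : ((doubled h x k - doubled h x l : ℤ) : ℝ) = ((2 * c : ℤ) : ℝ) := by
    push_cast
    rw [doubled_spec, doubled_spec, ← hc]
    ring
  exact_mod_cast this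

theorem doubled_latticeAction (h : IsStandard b e φ) {w : P.weylGroup}
    {σ : Equiv.Perm (Fin (n + 2))} {ε : Fin (n + 2) → ℤˣ} (hw : ActsBy φ w σ ε)
    (x : coweightLattice P) (k : Fin (n + 2)) :
    doubled h (latticeAction P w x) k = ε k * doubled h x (σ k) := by
  rw [← Int.cast_inj (α := ℝ), doubled_spec]
  push_cast
  rw [doubled_spec]
  have := hw x k
  change 2 * φ (coweightAction P w x) k = _
  rw [this]
  ring

/-! ### The doubled lattice and its reduction modulo 2q -/

variable [Finite ι] [P.IsCrystallographic] [P.IsReduced]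

/-- Together with `two_dvd_doubled_sub` this identifies the doubled lattice with the integer vectors
of constant parity: every root takes the value (±y_k ± y_l)/2 on such a vector, which is an integer.
-/
theorem exists_doubled_eq (h : IsStandard b e φ) (y : Fin (n + 2) → ℤ)
    (hy : ∀ k l, (2 : ℤ) ∣ y k - y l) : ∃ x, doubled h x = y := by
  have hφ : ∀ k, φ (φ.symm fun k => (y k : ℝ) / 2) k = (y k : ℝ) / 2 := by simp
  refine ⟨⟨φ.symm fun k => (y k : ℝ) / 2, fun i => ?_⟩, ?_⟩
  · obtain ⟨k, l, -, s, t, hst⟩ := h.exists_root'_eq i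
    rw [hst, hφ, hφ]
    obtain ⟨c, hc⟩ := hy k l
    have hc' : (y k : ℝ) = y l + 2 * c := by
      rw [← sub_eq_iff_eq_add']
      exact_mod_cast hc
    rw [hc']
    rcases Int.units_eq_one_or s with rfl | rfl <;> rcases Int.units_eq_one_or t with rfl | rfl
    · exact ⟨y l + c, by push_cast; ring⟩
    · exact ⟨c, by push_cast; ring⟩
    · exact ⟨-c, by push_cast; ring⟩
    · exact ⟨-y l - c, by push_cast; ring⟩
  · ext k
    rw [← Int.cast_inj (α := ℝ), doubled_spec]
    change 2 * φ (φ.symm fun k => (y k : ℝ) / 2) k = _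
    rw [hφ]
    ring

/-- The doubled vectors of qZ are q·y with all y_k even or all odd; modulo 2q these become 0 and q
respectively. -/
theorem mem_multiples_iff (h : IsStandard b e φ) {q : ℕ} (x : coweightLattice P) :
    x ∈ multiples P q ↔ (∀ k, ((doubled h x k : ℤ) : ZMod (2 * q)) = 0) ∨
      ∀ k, ((doubled h x k : ℤ) : ZMod (2 * q)) = q := by
  have hcast : ∀ m : ℤ, ((m : ℤ) : ZMod (2 * q)) = q ↔ ((2 * q : ℕ) : ℤ) ∣ m - q := by
    intro m
    rw [← ZMod.intCast_zmod_eq_zero_iff_dvd, Int.cast_sub, sub_eq_zero, Int.cast_natCast]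
  simp only [ZMod.intCast_zmod_eq_zero_iff_dvd, hcast]
  constructor
  · rintro ⟨z, rfl⟩
    have hz : ∀ k, doubled h (nsmulAddMonoidHom q z) k = q * doubled h z k := by
      intro k
      rw [nsmulAddMonoidHom_apply, map_nsmul, Pi.smul_apply, nsmul_eq_mul]
    simp only [hz]
    rcases Int.even_or_odd (doubled h z 0) with h0 | h0
    · left
      intro k
      obtain ⟨c, hc⟩ := two_dvd_doubled_sub h z k 0
      obtain ⟨d, hd⟩ := h0
      exact ⟨c + d, by rw [eq_add_of_sub_eq hc, hd]; push_cast; ring⟩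
    · right
      intro k
      obtain ⟨c, hc⟩ := two_dvd_doubled_sub h z k 0
      obtain ⟨d, hd⟩ := h0
      exact ⟨c + d, by rw [eq_add_of_sub_eq hc, hd]; push_cast; ring⟩
  · intro hx
    obtain ⟨y, hy, hxy⟩ : ∃ y : Fin (n + 2) → ℤ, (∀ k l, (2 : ℤ) ∣ y k - y l) ∧
        ∀ k, doubled h x k = q * y k := by
      rcases hx with hx | hx
      · choose c hc using hx
        exact ⟨fun k => 2 * c k, fun k l => ⟨c k - c l, by ring⟩, fun k => by
          rw [hc]; push_cast; ring⟩
      · choose c hc using hx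
        exact ⟨fun k => 2 * c k + 1, fun k l => ⟨c k - c l, by ring⟩, fun k => by
          rw [eq_add_of_sub_eq (hc k)]; push_cast; ring⟩
    obtain ⟨z, rfl⟩ := exists_doubled_eq h y hy
    refine ⟨z, doubled_injective h ?_⟩
    ext k
    rw [nsmulAddMonoidHom_apply, map_nsmul, Pi.smul_apply, nsmul_eq_mul, hxy]

/-- The class modulo `2` of an element of `ZMod (2 * q)`. -/
def parity (q : ℕ) : ZMod (2 * q) →+* ZMod 2 := ZMod.castHom (dvd_mul_right 2 q) (ZMod 2)

/-- The doubled coordinates of the points of the complement of the arrangement. -/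
def IsConfiguration (q : ℕ) (y : Fin (n + 2) → ZMod (2 * q)) : Prop :=
  (∀ k l, parity q (y k) = parity q (y l)) ∧ ∀ k l, k ≠ l → y k ≠ y l ∧ y k ≠ -y l

/-- The doubled coordinates of the points fixed by a signed permutation. -/
def IsFixedBy (q : ℕ) (σ : Equiv.Perm (Fin (n + 2))) (ε : Fin (n + 2) → ℤˣ)
    (y : Fin (n + 2) → ZMod (2 * q)) : Prop :=
  (∀ k, ((ε k : ℤ) : ZMod (2 * q)) * y (σ k) = y k) ∨
    ∀ k, ((ε k : ℤ) : ZMod (2 * q)) * y (σ k) = y k + q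

theorem natCast_add_self (q : ℕ) : (q : ZMod (2 * q)) + q = 0 := by
  rw [← two_mul]
  exact_mod_cast ZMod.natCast_self (2 * q)

theorem neg_natCast_eq (q : ℕ) : -(q : ZMod (2 * q)) = q :=
  neg_eq_of_add_eq_zero_left (natCast_add_self q)

theorem natCast_ne_zero {q : ℕ} (hq : 0 < q) : (q : ZMod (2 * q)) ≠ 0 := by
  rw [Ne, ZMod.natCast_eq_zero_iff]
  intro h
  have := Nat.le_of_dvd hq h
  omega

omit [Finite ι] [P.IsCrystallographic] [P.IsReduced] in
theorem IsConfiguration.add {q : ℕ} {y : Fin (n + 2) → ZMod (2 * q)} (hy : IsConfiguration q y) :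
    IsConfiguration q (fun k => y k + q) := by
  refine ⟨fun k l => by rw [map_add, map_add, hy.1 k l], fun k l hkl => ⟨fun h => ?_, fun h => ?_⟩⟩
  · exact (hy.2 k l hkl).1 (add_right_cancel h)
  · rw [neg_add, neg_natCast_eq] at h
    exact (hy.2 k l hkl).2 (add_right_cancel h)

theorem IsFixedBy.add {q : ℕ} {σ : Equiv.Perm (Fin (n + 2))} {ε : Fin (n + 2) → ℤˣ}
    {y : Fin (n + 2) → ZMod (2 * q)} (hy : IsFixedBy q σ ε y) :
    IsFixedBy q σ ε (fun k => y k + q) := by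
  have hε : ∀ k, ((ε k : ℤ) : ZMod (2 * q)) * q = q := by
    intro k
    rcases Int.units_eq_one_or (ε k) with h | h <;> simp [h, neg_natCast_eq]
  rcases hy with hy | hy
  · exact Or.inl fun k => by rw [mul_add, hε, hy]
  · exact Or.inr fun k => by rw [mul_add, hε, hy]

/-- The doubled coordinates modulo `2 * q`. -/
noncomputable def reduced (h : IsStandard b e φ) (q : ℕ) (x : coweightLattice P) (k : Fin (n + 2)) :
    ZMod (2 * q) :=
  (doubled h x k : ℤ)

theorem mk_eq_mk_iff (h : IsStandard b e φ) {q : ℕ} (x x' : coweightLattice P) :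
    (x : ModLattice P q) = x' ↔ (∀ k, reduced h q x' k = reduced h q x k) ∨
      ∀ k, reduced h q x' k = reduced h q x k + q := by
  rw [QuotientAddGroup.eq, mem_multiples_iff h]
  simp only [neg_add_eq_sub, map_sub, Pi.sub_apply, Int.cast_sub, reduced, sub_eq_iff_eq_add',
    add_zero]

omit [Finite ι] [P.IsCrystallographic] [P.IsReduced] in
theorem isConfiguration_reduced (h : IsStandard b e φ) {q : ℕ} {x : coweightLattice P}
    (hx : ∀ i, ¬ ∃ m : ℤ, P.root' i (x : N) = (q : ℝ) * m) :
    IsConfiguration q (reduced h q x) := by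
  refine ⟨fun k l => ?_, fun k l hkl => ⟨fun heq => ?_, fun heq => ?_⟩⟩
  · rw [reduced, reduced, map_intCast, map_intCast, ← sub_eq_zero, ← Int.cast_sub,
      ZMod.intCast_zmod_eq_zero_iff_dvd]
    exact two_dvd_doubled_sub h x k l
  · obtain ⟨i, hi⟩ := h.exists_root_sub hkl
    rw [reduced, reduced, ← sub_eq_zero, ← Int.cast_sub, ZMod.intCast_zmod_eq_zero_iff_dvd] at heq
    obtain ⟨m, hm⟩ := heq
    refine hx i ⟨m, ?_⟩
    have : ((doubled h x k - doubled h x l : ℤ) : ℝ) = ((2 * q : ℕ) * m : ℤ) := by rw [hm]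
    push_cast at this
    rw [doubled_spec, doubled_spec] at this
    rw [hi]
    linarith
  · obtain ⟨i, hi⟩ := h.exists_root_add hkl
    rw [reduced, reduced, ← sub_eq_zero, sub_neg_eq_add, ← Int.cast_add,
      ZMod.intCast_zmod_eq_zero_iff_dvd] at heq
    obtain ⟨m, hm⟩ := heq
    refine hx i ⟨m, ?_⟩
    have : ((doubled h x k + doubled h x l : ℤ) : ℝ) = ((2 * q : ℕ) * m : ℤ) := by rw [hm]
    push_cast at this
    rw [doubled_spec, doubled_spec] at this
    rw [hi]
    linarith

theorem not_exists_root'_eq (h : IsStandard b e φ) {q : ℕ} {x : coweightLattice P}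
    (hx : IsConfiguration q (reduced h q x)) (i : ι) :
    ¬ ∃ m : ℤ, P.root' i (x : N) = (q : ℝ) * m := by
  rintro ⟨m, hm⟩
  obtain ⟨k, l, hkl, s, t, hst⟩ := h.exists_root'_eq i
  have hD : (s : ℤ) * doubled h x k + t * doubled h x l = (2 * q : ℕ) * m := by
    rw [← Int.cast_inj (α := ℝ)]
    push_cast
    rw [doubled_spec, doubled_spec]
    rw [hst] at hm
    linarith
  have hD' := congrArg (Int.cast : ℤ → ZMod (2 * q)) hD
  rw [Int.cast_mul ((2 * q : ℕ) : ℤ), Int.cast_natCast, ZMod.natCast_self, zero_mul] at hD'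
  push_cast at hD'
  obtain ⟨h1, h2⟩ := hx.2 k l hkl
  rw [reduced, reduced] at h1 h2
  rcases Int.units_eq_one_or s with rfl | rfl <;> rcases Int.units_eq_one_or t with rfl | rfl <;>
    push_cast at hD'
  · exact h2 (by linear_combination hD')
  · exact h1 (by linear_combination hD')
  · exact h1 (by linear_combination -hD')
  · exact h2 (by linear_combination -hD')

/-- Membership only asks for some good representative; since configurations are stable under adding
q to all coordinates, every representative is then good. -/
theorem mk_mem_modComplement_iff (h : IsStandard b e φ) {q : ℕ} (x : coweightLattice P) :
    (x : ModLattice P q) ∈ modComplement P q ↔ IsConfiguration q (reduced h q x) := by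
  refine ⟨?_, fun hx => ⟨x, rfl, not_exists_root'_eq h hx⟩⟩
  rintro ⟨x', hx', hc⟩
  have hconf := isConfiguration_reduced h hc
  rcases (mk_eq_mk_iff h x' x).1 hx' with heq | heq
  · rwa [funext heq]
  · rw [funext heq]
    exact hconf.add

theorem modAction_mk_eq_iff (h : IsStandard b e φ) {q : ℕ} {w : P.weylGroup}
    {σ : Equiv.Perm (Fin (n + 2))} {ε : Fin (n + 2) → ℤˣ} (hw : ActsBy φ w σ ε)
    (x : coweightLattice P) :
    modAction P q w (x : ModLattice P q) = x ↔ IsFixedBy q σ ε (reduced h q x) := by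
  rw [eq_comm]
  change (x : ModLattice P q) = (latticeAction P w x : coweightLattice P) ↔ _
  rw [mk_eq_mk_iff h]
  simp only [reduced, doubled_latticeAction h hw, Int.cast_mul, IsFixedBy]

theorem exists_reduced_eq (h : IsStandard b e φ) {q : ℕ} (hq : 0 < q)
    (y : Fin (n + 2) → ZMod (2 * q)) (hy : ∀ k l, parity q (y k) = parity q (y l)) :
    ∃ x, reduced h q x = y := by
  have : NeZero (2 * q) := ⟨by omega⟩
  have hval : ∀ k, ((y k).val : ZMod (2 * q)) = y k := fun k => ZMod.natCast_zmod_val (y k)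
  obtain ⟨x, hx⟩ := exists_doubled_eq h (fun k => ((y k).val : ℤ)) fun k l => by
    have h1 := hy k l
    rw [← hval k, ← hval l, map_natCast, map_natCast, ← sub_eq_zero] at h1
    have := (ZMod.intCast_zmod_eq_zero_iff_dvd (((y k).val : ℤ) - (y l).val) 2).1
      (by push_cast; exact h1)
    exact_mod_cast this
  refine ⟨x, funext fun k => ?_⟩
  rw [reduced, hx, Int.cast_natCast, hval]

/-- The Boolean selects one of the two lifts of a point, which differ by q in every coordinate and
are distinct because q ≠ 0 in ℤ/2q. -/
theorem two_mul_equivChar (h : IsStandard b e φ) {q : ℕ} (hq : 0 < q) {w : P.weylGroup}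
    {σ : Equiv.Perm (Fin (n + 2))} {ε : Fin (n + 2) → ℤˣ} (hw : ActsBy φ w σ ε) :
    2 * equivChar P q w =
      Nat.card {y : Fin (n + 2) → ZMod (2 * q) // IsConfiguration q y ∧ IsFixedBy q σ ε y} := by
  have hout : ∀ m : ModLattice P q, ((Quotient.out m : coweightLattice P) : ModLattice P q) = m :=
    fun m => Quotient.out_eq m
  have hmem : ∀ m : ModLattice P q, m ∈ modComplement P q ∧ modAction P q w m = m →
      IsConfiguration q (reduced h q (Quotient.out m)) ∧
        IsFixedBy q σ ε (reduced h q (Quotient.out m)) := by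
    intro m hm
    rw [← hout m, mk_mem_modComplement_iff h, modAction_mk_eq_iff h hw] at hm
    exact hm
  have htwo : 2 * equivChar P q w = Nat.card (Bool × {y : ModLattice P q //
      y ∈ modComplement P q ∧ modAction P q w y = y}) := by
    rw [Nat.card_prod, Nat.card_eq_fintype_card, Fintype.card_bool, equivChar]
  rw [htwo]
  refine Nat.card_eq_of_bijective (fun p => bif p.1
    then ⟨fun k => reduced h q (Quotient.out p.2.1) k + q, (hmem _ p.2.2).1.add,
      (hmem _ p.2.2).2.add⟩
    else ⟨reduced h q (Quotient.out p.2.1), hmem _ p.2.2⟩) ⟨?_, ?_⟩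
  · have key : ∀ m m' : ModLattice P q,
        ((∀ k, reduced h q (Quotient.out m') k = reduced h q (Quotient.out m) k) ∨
          ∀ k, reduced h q (Quotient.out m') k = reduced h q (Quotient.out m) k + q) →
        m = m' := by
      intro m m' hmm
      rw [← hout m, ← hout m']
      exact (mk_eq_mk_iff h _ _).2 hmm
    have hq0 := natCast_ne_zero hq
    rintro ⟨c, m, hm⟩ ⟨c', m', hm'⟩ heq
    cases c <;> cases c' <;> simp only [cond_true, cond_false, Subtype.mk.injEq] at heq
    · obtain rfl := key m m' (Or.inl fun k => (congrFun heq k).symm)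
      rfl
    · obtain rfl := key m' m (Or.inr fun k => congrFun heq k)
      exact absurd (congrFun heq 0) (by simpa using hq0)
    · obtain rfl := key m m' (Or.inr fun k => (congrFun heq k).symm)
      exact absurd (congrFun heq 0) (by simpa using hq0)
    · obtain rfl := key m m' (Or.inl fun k => (add_right_cancel (congrFun heq k)).symm)
      rfl
  · rintro ⟨y, hy1, hy2⟩
    obtain ⟨x, rfl⟩ := exists_reduced_eq h hq y hy1.1
    have hx : (x : ModLattice P q) ∈ modComplement P q ∧
        modAction P q w (x : ModLattice P q) = x :=
      ⟨(mk_mem_modComplement_iff h x).2 hy1, (modAction_mk_eq_iff h hw x).2 hy2⟩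
    rcases (mk_eq_mk_iff h _ _).1 (hout (x : ModLattice P q)) with heq | heq
    · exact ⟨⟨false, x, hx⟩, Subtype.ext (funext fun k => (heq k).symm)⟩
    · exact ⟨⟨true, x, hx⟩, Subtype.ext (funext fun k => (heq k).symm)⟩

end Reduction

/-! ### Counting configurations -/

section Configurations

theorem add_self_eq_zero_iff {q : ℕ} (a : ZMod (2 * q)) : a + a = 0 ↔ a = 0 ∨ a = q := by
  constructor
  · intro h
    obtain ⟨m, rfl⟩ := ZMod.intCast_surjective a
    rw [← Int.cast_add, ZMod.intCast_zmod_eq_zero_iff_dvd] at h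
    obtain ⟨c, hc⟩ := h
    push_cast at hc
    have hm : m = q * c := by linarith
    rcases Int.even_or_odd' c with ⟨d, rfl | rfl⟩
    · left
      rw [ZMod.intCast_zmod_eq_zero_iff_dvd]
      exact ⟨d, by rw [hm]; push_cast; ring⟩
    · right
      rw [← sub_eq_zero, ← Int.cast_natCast, ← Int.cast_sub, ZMod.intCast_zmod_eq_zero_iff_dvd]
      exact ⟨d, by rw [hm]; push_cast; ring⟩
  · rintro (rfl | rfl)
    · exact add_zero 0
    · exact natCast_add_self q

theorem parity_natCast (q m : ℕ) : parity q (m : ZMod (2 * q)) = m := map_natCast _ _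

theorem parity_neg {q : ℕ} (a : ZMod (2 * q)) : parity q (-a) = parity q a := by
  rw [map_neg, ZMod.neg_eq_self_mod_two]

section Finite

variable (q : ℕ) [NeZero (2 * q)]

/-- The elements of `ZMod (2 * q)` of given parity. -/
def parityClass (p : ZMod 2) : Finset (ZMod (2 * q)) :=
  Finset.univ.filter fun a => parity q a = p

variable {q}

theorem mem_parityClass {p : ZMod 2} {a : ZMod (2 * q)} :
    a ∈ parityClass q p ↔ parity q a = p := by
  simp [parityClass]

/-- Adding 1 is a bijection between the two parity classes, which together have 2q elements. -/
theorem card_parityClass (p : ZMod 2) : (parityClass q p).card = q := by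
  have hsucc : ∀ p, (parityClass q p).card = (parityClass q (p + 1)).card := by
    intro p
    refine Finset.card_bij' (fun a _ => a + 1) (fun a _ => a - 1) ?_ ?_ ?_ ?_
    · intro a ha
      rw [mem_parityClass] at ha ⊢
      rw [map_add, map_one, ha]
    · intro a ha
      rw [mem_parityClass] at ha ⊢
      rw [map_sub, map_one, ha, add_sub_cancel_right]
    · intro a _
      exact add_sub_cancel_right a 1
    · intro a _
      exact sub_add_cancel a 1
  have hsum : 2 * q = ∑ p : ZMod 2, (parityClass q p).card := by
    have := Finset.card_eq_sum_card_fiberwise (f := parity q) (s := Finset.univ)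
      (t := Finset.univ) (fun _ _ => Finset.mem_coe.2 (Finset.mem_univ _))
    rw [Finset.card_univ, ZMod.card] at this
    exact this
  have h01 : (parityClass q 0).card = (parityClass q 1).card := hsucc 0
  have huniv : ∑ p : ZMod 2, (parityClass q p).card =
      (parityClass q 0).card + (parityClass q 1).card := Fin.sum_univ_two _
  have : p = 0 ∨ p = 1 := by
    revert p
    decide
  rcases this with rfl | rfl <;> omega

/-- The elements equal to `a` up to sign. -/
def signClass (a : ZMod (2 * q)) : Finset (ZMod (2 * q)) := {a, -a}

theorem card_apartTuples_sign (n : ℕ) (S : Finset (ZMod (2 * q))) (hS : ∀ a ∈ S, -a ∈ S) :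
    ((apartTuples signClass n S).card : ℚ) =
      tupleCount 2 n (S.filter fun a => ¬ a + a = 0).card (S.filter fun a => a + a = 0).card := by
  have hone : ∀ a : ZMod (2 * q), (signClass a).card = 1 ↔ a + a = 0 := by
    intro a
    rw [signClass, add_eq_zero_iff_eq_neg]
    constructor
    · intro h
      by_contra hne
      rw [Finset.card_pair hne] at h
      omega
    · intro h
      rw [← h, Finset.pair_eq_singleton, Finset.card_singleton]
  have htwo : ∀ a : ZMod (2 * q), (signClass a).card = 2 ↔ ¬ a + a = 0 := by
    intro a
    rw [← hone]
    have h1 : (signClass a).card ≤ 2 := Finset.card_le_two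
    have h2 : 0 < (signClass a).card := Finset.card_pos.2 ⟨a, by simp [signClass]⟩
    omega
  have h := card_apartTuples signClass 2 (by norm_num) (fun a => by simp [signClass])
    (fun a b hb => by
      rw [signClass, Finset.mem_insert, Finset.mem_singleton] at hb
      rcases hb with rfl | rfl
      · rfl
      · rw [signClass, signClass, neg_neg, Finset.pair_comm]) n S
    (fun a ha b hb => by
      rw [signClass, Finset.mem_insert, Finset.mem_singleton] at hb
      rcases hb with rfl | rfl
      exacts [ha, hS _ ha])
    (fun a _ => by
      by_cases h : a + a = 0
      · exact Or.inl ((hone a).2 h)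
      · exact Or.inr ((htwo a).2 h))
  simpa only [hone, htwo, Nat.cast_ofNat] using h

theorem card_filter_not_add_self (p : ZMod 2) :
    (((parityClass q p).filter fun a => ¬ a + a = 0).card : ℚ) =
      q - ((parityClass q p).filter fun a => a + a = 0).card := by
  have hsplit := Finset.card_filter_add_card_filter_not (s := parityClass q p) (fun a => a + a = 0)
  rw [card_parityClass] at hsplit
  rw [eq_sub_iff_add_eq']
  exact_mod_cast hsplit

theorem card_apartTuples_parityClass (n : ℕ) (p : ZMod 2) :
    ((apartTuples signClass n (parityClass q p)).card : ℚ) =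
      tupleCount 2 n (q - ((parityClass q p).filter fun a => a + a = 0).card)
        ((parityClass q p).filter fun a => a + a = 0).card := by
  rw [card_apartTuples_sign, card_filter_not_add_self]
  intro a ha
  rw [mem_parityClass] at ha ⊢
  rw [parity_neg, ha]

theorem filter_add_self (p : ZMod 2) :
    ((parityClass q p).filter fun a => a + a = 0) =
      ({0, (q : ZMod (2 * q))} : Finset _).filter fun a => parity q a = p := by
  ext a
  simp only [Finset.mem_filter, mem_parityClass, add_self_eq_zero_iff, Finset.mem_insert,
    Finset.mem_singleton]
  tauto

theorem isConfiguration_iff {n : ℕ} (y : Fin (n + 2) → ZMod (2 * q)) :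
    IsConfiguration q y ↔ y ∈ apartTuples signClass (n + 2) (parityClass q (parity q (y 0))) := by
  simp only [IsConfiguration, mem_apartTuples, mem_parityClass, signClass, Finset.mem_insert,
    Finset.mem_singleton, not_or]
  refine and_congr_left fun _ => ⟨fun h i => h i 0, fun h i j => by rw [h i, h j]⟩

theorem card_isConfiguration (n : ℕ) :
    Nat.card {y : Fin (n + 2) → ZMod (2 * q) // IsConfiguration q y} =
      (apartTuples signClass (n + 2) (parityClass q 0)).card +
        (apartTuples signClass (n + 2) (parityClass q 1)).card := by
  classical
  rw [Nat.card_eq_fintype_card, Fintype.card_subtype, ← Finset.card_union_of_disjoint]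
  · congr 1
    ext y
    simp only [Finset.mem_filter, Finset.mem_univ, true_and, Finset.mem_union,
      isConfiguration_iff]
    constructor
    · intro h
      have : ∀ p : ZMod 2, p = 0 ∨ p = 1 := by decide
      rcases this (parity q (y 0)) with h0 | h0 <;> rw [h0] at h
      exacts [Or.inl h, Or.inr h]
    · rintro (h | h) <;>
        rwa [mem_parityClass.1 ((mem_apartTuples.1 h).1 0)]
  · rw [Finset.disjoint_left]
    intro y h0 h1
    have h0' := mem_parityClass.1 ((mem_apartTuples.1 h0).1 0)
    have h1' := mem_parityClass.1 ((mem_apartTuples.1 h1).1 0)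
    rw [h0'] at h1'
    exact absurd h1' (by decide)

/-- For q odd, 0 and q have different parities, so each parity class has one singleton sign class
and both contribute equally. -/
theorem card_isConfiguration_of_odd (hq : ¬ 2 ∣ q) (n : ℕ) :
    (Nat.card {y : Fin (n + 2) → ZMod (2 * q) // IsConfiguration q y} : ℚ) =
      2 * ((∏ i ∈ Finset.range (n + 1), ((q : ℚ) - (2 * (i : ℚ) + 1))) * (q - (n + 1))) := by
  have hparity : parity q (q : ZMod (2 * q)) = 1 := by
    rw [parity_natCast, ZMod.natCast_eq_one_iff_odd]
    exact Nat.not_even_iff_odd.1 (fun h => hq h.two_dvd)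
  have h0 : ((parityClass q 0).filter fun a => a + a = 0).card = 1 := by
    rw [filter_add_self, Finset.filter_insert, Finset.filter_singleton, hparity]
    simp
  have h1 : ((parityClass q 1).filter fun a => a + a = 0).card = 1 := by
    rw [filter_add_self, Finset.filter_insert, Finset.filter_singleton, hparity]
    simp
  rw [card_isConfiguration, Nat.cast_add, card_apartTuples_parityClass, card_apartTuples_parityClass, h0, h1,
    Nat.cast_one, tupleCount_one, ← two_mul]
  congr 2
  · exact Finset.prod_congr rfl fun i _ => by ring
  · push_cast
    ring

theorem card_filter_add_self_zero (hq0 : 0 < q) (hq : 2 ∣ q) :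
    ((parityClass q 0).filter fun a => a + a = 0).card = 2 := by
  have hparity : parity q (q : ZMod (2 * q)) = 0 := by
    rw [parity_natCast, ZMod.natCast_eq_zero_iff]
    exact hq
  rw [filter_add_self, Finset.filter_insert, Finset.filter_singleton, hparity, map_zero,
    if_pos rfl, if_pos rfl, Finset.card_pair (natCast_ne_zero hq0).symm]

/-- For q even, both singleton sign classes {0} and {q} lie in the even class and none in the odd
class; the two contributions differ and share n linear factors. -/
theorem card_isConfiguration_of_even (hq0 : 0 < q) (hq : 2 ∣ q) (n : ℕ) :
    (Nat.card {y : Fin (n + 2) → ZMod (2 * q) // IsConfiguration q y} : ℚ) =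
      2 * ((∏ i ∈ Finset.range n, ((q : ℚ) - 2 * ((i : ℚ) + 1))) *
        ((q : ℚ) ^ 2 - 2 * (n + 1) * q + (n + 2) * (n + 1) / 2)) := by
  have hparity : parity q (q : ZMod (2 * q)) = 0 := by
    rw [parity_natCast, ZMod.natCast_eq_zero_iff]
    exact hq
  have h1 : ((parityClass q 1).filter fun a => a + a = 0).card = 0 := by
    rw [filter_add_self, Finset.filter_insert, Finset.filter_singleton, hparity, map_zero,
      if_neg (by decide), if_neg (by decide), Finset.card_empty]
  rw [card_isConfiguration, Nat.cast_add, card_apartTuples_parityClass, card_apartTuples_parityClass,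
    card_filter_add_self_zero hq0 hq, h1, Nat.cast_zero, sub_zero, Nat.cast_ofNat, tupleCount_two, tupleCount_zero,
    Finset.prod_range_succ', Finset.prod_range_succ]
  have hprod : ∏ i ∈ Finset.range n, ((q : ℚ) - 2 - 2 * i) =
      ∏ i ∈ Finset.range n, ((q : ℚ) - 2 * ((i : ℚ) + 1)) :=
    Finset.prod_congr rfl fun i _ => by ring
  rw [hprod]
  push_cast
  ring

/-- Tuples with prescribed ends and middle part. -/
theorem card_filter_ends {α : Type*} [Fintype α] [DecidableEq α] (n : ℕ) (D : Finset (α × α))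
    (B : Finset (Fin n → α)) :
    (Finset.univ.filter fun y : Fin (n + 2) → α =>
      (y 0, y (Fin.last (n + 1))) ∈ D ∧ (fun i : Fin n => y i.castSucc.succ) ∈ B).card =
        D.card * B.card := by
  have hlast : ∀ (a c : α) (z : Fin n → α),
      (Fin.cons a (Fin.snoc z c : Fin (n + 1) → α) : Fin (n + 2) → α) (Fin.last (n + 1)) = c := by
    intro a c z
    rw [← Fin.succ_last, Fin.cons_succ, Fin.snoc_last]
  rw [← Finset.card_product]
  refine Finset.card_bij' (fun y _ => ((y 0, y (Fin.last (n + 1))), fun i => y i.castSucc.succ))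
    (fun p _ => (Fin.cons p.1.1 (Fin.snoc p.2 p.1.2 : Fin (n + 1) → α) : Fin (n + 2) → α))
    ?_ ?_ ?_ ?_
  · intro y hy
    simpa using hy
  · rintro ⟨⟨a, c⟩, z⟩ h
    simpa only [Finset.mem_filter, Finset.mem_univ, true_and, hlast, Fin.cons_zero, Fin.cons_succ,
      Fin.snoc_castSucc, Finset.mem_product] using h
  · intro y _
    ext i
    refine Fin.cases ?_ (fun i => ?_) i
    · simp
    · refine Fin.lastCases ?_ (fun i => ?_) i <;> simp
  · rintro ⟨⟨a, c⟩, z⟩ _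
    simp only [hlast, Fin.cons_zero, Fin.cons_succ, Fin.snoc_castSucc]

end Finite

/-! ### Configurations fixed by ω_1 -/

theorem isFixedBy_omega_zero_iff {n q : ℕ} (hq : 0 < q) (hn : 1 ≤ n)
    (y : Fin (n + 2) → ZMod (2 * q)) :
    IsFixedBy q 1 (fun k => if k = 0 ∨ k = Fin.last (n + 1) then -1 else 1) y ↔
      y 0 + y 0 = 0 ∧ y (Fin.last (n + 1)) + y (Fin.last (n + 1)) = 0 := by
  have hneg : ∀ a : ZMod (2 * q), -a = a ↔ a + a = 0 := fun a => by
    rw [add_eq_zero_iff_eq_neg, eq_comm]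
  constructor
  · rintro (h | h)
    · have h1 := h 0
      have h2 := h (Fin.last (n + 1))
      simp only [true_or, or_true, if_true, Equiv.Perm.one_apply] at h1 h2
      push_cast at h1 h2
      rw [neg_one_mul, hneg] at h1 h2
      exact ⟨h1, h2⟩
    -- The second coordinate is not moved, so being fixed up to the translation would give q = 0 in
    -- ℤ/2q.
    · have h1 := h ⟨1, by omega⟩
      beta_reduce at h1
      rw [if_neg (by simp [Fin.ext_iff]; omega)] at h1
      simp only [Units.val_one, Int.cast_one, one_mul, Equiv.Perm.one_apply] at h1
      exact absurd (left_eq_add.1 h1) (natCast_ne_zero hq)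
  · rintro ⟨h0, h1⟩
    left
    intro k
    beta_reduce
    by_cases hk : k = 0 ∨ k = Fin.last (n + 1)
    · rw [if_pos hk, Equiv.Perm.one_apply]
      push_cast
      rw [neg_one_mul, hneg]
      rcases hk with rfl | rfl <;> assumption
    · rw [if_neg hk]
      simp

/-- The end entries would be distinct elements of {0, q}, but these have different parities. -/
theorem card_omega_zero_of_odd {n q : ℕ} (hq0 : 0 < q) (hn : 1 ≤ n) (hq : ¬ 2 ∣ q) :
    Nat.card {y : Fin (n + 2) → ZMod (2 * q) // IsConfiguration q y ∧
      IsFixedBy q 1 (fun k => if k = 0 ∨ k = Fin.last (n + 1) then -1 else 1) y} = 0 := by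
  have hparity : parity q (q : ZMod (2 * q)) = 1 := by
    rw [parity_natCast, ZMod.natCast_eq_one_iff_odd]
    exact Nat.not_even_iff_odd.1 (fun h => hq h.two_dvd)
  rw [Nat.card_eq_zero]
  left
  refine ⟨fun ⟨y, hy, hfix⟩ => ?_⟩
  rw [isFixedBy_omega_zero_iff hq0 hn, add_self_eq_zero_iff, add_self_eq_zero_iff] at hfix
  have hne := (hy.2 0 (Fin.last (n + 1)) (by simp [Fin.ext_iff])).1
  have hpar := hy.1 0 (Fin.last (n + 1))
  rcases hfix with ⟨h0 | h0, h1 | h1⟩ <;> rw [h0, h1] at hne hpar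
  · exact hne rfl
  · rw [hparity, map_zero] at hpar
    exact absurd hpar (by decide)
  · rw [hparity, map_zero] at hpar
    exact absurd hpar (by decide)
  · exact hne rfl

/-- The ends are 0 and q in either order, giving the factor 2 and even parity. The middle entries
come from the q - 2 even elements with a two-element sign class. -/
theorem card_omega_zero_of_even {n q : ℕ} (hq0 : 0 < q) (hn : 1 ≤ n) (hq : 2 ∣ q) :
    (Nat.card {y : Fin (n + 2) → ZMod (2 * q) // IsConfiguration q y ∧
      IsFixedBy q 1 (fun k => if k = 0 ∨ k = Fin.last (n + 1) then -1 else 1) y} : ℚ) =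
        2 * ∏ i ∈ Finset.range n, ((q : ℚ) - 2 * ((i : ℚ) + 1)) := by
  classical
  have : NeZero (2 * q) := ⟨by omega⟩
  have hparity : parity q (q : ZMod (2 * q)) = 0 := by
    rw [parity_natCast, ZMod.natCast_eq_zero_iff]
    exact hq
  have hlast : (0 : Fin (n + 2)) ≠ Fin.last (n + 1) := by simp [Fin.ext_iff]
  let S := (parityClass q 0).filter fun a => ¬ a + a = 0
  let D : Finset (ZMod (2 * q) × ZMod (2 * q)) := {(0, (q : ZMod (2 * q))), ((q : ZMod (2 * q)), 0)}
  have hS : ((apartTuples signClass n S).card : ℚ) =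
      ∏ i ∈ Finset.range n, ((q : ℚ) - 2 * ((i : ℚ) + 1)) := by
    rw [card_apartTuples_sign, Finset.filter_filter, Finset.filter_filter,
      Finset.filter_false_of_mem (p := fun a => (¬ a + a = 0) ∧ a + a = 0) (by tauto)]
    · simp only [and_self, Finset.card_empty, Nat.cast_zero]
      rw [card_filter_not_add_self, card_filter_add_self_zero hq0 hq, tupleCount_zero]
      exact Finset.prod_congr rfl fun i _ => by push_cast; ring
    · intro a ha
      rw [Finset.mem_filter, mem_parityClass] at ha ⊢
      rw [parity_neg, ← neg_add, neg_eq_zero]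
      exact ha
  have hD : D.card = 2 := Finset.card_pair fun h =>
    natCast_ne_zero hq0 (congrArg Prod.fst h).symm
  rw [← hS]
  refine Eq.trans (b := ((D.card * (apartTuples signClass n S).card : ℕ) : ℚ)) ?_
    (by rw [Nat.cast_mul, hD, Nat.cast_ofNat])
  rw [← card_filter_ends, Nat.card_eq_fintype_card, Fintype.card_subtype, Nat.cast_inj]
  congr 1
  ext y
  simp only [Finset.mem_filter, Finset.mem_univ, true_and, isFixedBy_omega_zero_iff hq0 hn]
  have hDmem : (y 0, y (Fin.last (n + 1))) ∈ D ↔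
      y 0 = 0 ∧ y (Fin.last (n + 1)) = q ∨ y 0 = q ∧ y (Fin.last (n + 1)) = 0 := by
    simp [D]
  rw [hDmem, mem_apartTuples]
  simp only [S, Finset.mem_filter, mem_parityClass, signClass, Finset.mem_insert,
    Finset.mem_singleton, not_or]
  constructor
  · rintro ⟨⟨hpar, hne⟩, h0, h1⟩
    rw [add_self_eq_zero_iff] at h0 h1
    have h01 := (hne _ _ hlast).1
    have hends : y 0 = 0 ∧ y (Fin.last (n + 1)) = q ∨ y 0 = q ∧ y (Fin.last (n + 1)) = 0 := by
      rcases h0 with h0 | h0 <;> rcases h1 with h1 | h1 <;> rw [h0, h1] at h01 <;> tauto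
    have hpar0 : parity q (y 0) = 0 := by
      rcases h0 with h0 | h0 <;> rw [h0]
      exacts [map_zero _, hparity]
    refine ⟨hends, fun i => ⟨by rw [hpar _ 0, hpar0], fun h => ?_⟩, fun i j hij =>
      hne _ _ fun h => hij (Fin.castSucc_injective _ (Fin.succ_injective _ h))⟩
    rw [add_self_eq_zero_iff] at h
    have hi0 := (hne i.castSucc.succ 0 (Fin.succ_ne_zero _)).1
    have hil := (hne i.castSucc.succ (Fin.last (n + 1)) (by simp [Fin.ext_iff]; omega)).1
    rcases hends with ⟨e0, e1⟩ | ⟨e0, e1⟩ <;> rw [e0] at hi0 <;> rw [e1] at hil <;> tauto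
  · rintro ⟨hends, hmid, hne⟩
    have h0 : y 0 + y 0 = 0 := by
      rw [add_self_eq_zero_iff]
      tauto
    have h1 : y (Fin.last (n + 1)) + y (Fin.last (n + 1)) = 0 := by
      rw [add_self_eq_zero_iff]
      tauto
    have hcases : ∀ k, k = 0 ∨ k = Fin.last (n + 1) ∨ ∃ i : Fin n, k = i.castSucc.succ := by
      intro k
      refine Fin.cases (Or.inl rfl) (fun k => Or.inr ?_) k
      refine Fin.lastCases (Or.inl (Fin.succ_last n)) (fun k => Or.inr ⟨k, rfl⟩) k
    have hpar : ∀ k, parity q (y k) = 0 := by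
      intro k
      rcases hcases k with rfl | rfl | ⟨i, rfl⟩
      · rcases hends with ⟨h, -⟩ | ⟨h, -⟩ <;> rw [h]
        exacts [map_zero _, hparity]
      · rcases hends with ⟨-, h⟩ | ⟨-, h⟩ <;> rw [h]
        exacts [hparity, map_zero _]
      · exact (hmid i).1
    have hq' := natCast_ne_zero hq0
    have h01 : y 0 ≠ y (Fin.last (n + 1)) := by
      rcases hends with ⟨e0, e1⟩ | ⟨e0, e1⟩ <;> rw [e0, e1]
      exacts [hq'.symm, hq']
    have hnegl : -y (Fin.last (n + 1)) = y (Fin.last (n + 1)) := neg_eq_of_add_eq_zero_left h1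
    have hneg0 : -y 0 = y 0 := neg_eq_of_add_eq_zero_left h0
    have hmix : ∀ a c : ZMod (2 * q), a + a = 0 → ¬ c + c = 0 → (a ≠ c ∧ a ≠ -c) ∧
        c ≠ a ∧ c ≠ -a := by
      intro a c ha hc
      refine ⟨⟨?_, ?_⟩, ?_, ?_⟩ <;> intro h <;> apply hc
      · rw [← h, ha]
      · rw [← neg_eq_zero, neg_add, ← h, ha]
      · rw [h, ha]
      · rw [h, ← neg_add, ha, neg_zero]
    refine ⟨⟨fun k l => by rw [hpar, hpar], fun k l hkl => ?_⟩, h0, h1⟩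
    rcases hcases k with rfl | rfl | ⟨i, rfl⟩ <;> rcases hcases l with rfl | rfl | ⟨j, rfl⟩
    · exact absurd rfl hkl
    · rw [hnegl]
      exact ⟨h01, h01⟩
    · exact (hmix _ _ h0 (hmid j).2).1
    · rw [hneg0]
      exact ⟨h01.symm, h01.symm⟩
    · exact absurd rfl hkl
    · exact (hmix _ _ h1 (hmid j).2).1
    · exact (hmix _ _ h0 (hmid i).2).2
    · exact (hmix _ _ h1 (hmid i).2).2
    · exact hne i j fun h => hkl (by rw [h])

end Configurations

/-! ### Configurations fixed by a rotation of order four -/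

section Quarter

/-- The orbit of `a` under `a ↦ -a` and `a ↦ a + q`. -/
def quadClass {q : ℕ} (a : ZMod (2 * q)) : Finset (ZMod (2 * q)) := {a, -a, q - a, q + a}

theorem mem_quadClass {q : ℕ} {a c : ZMod (2 * q)} :
    c ∈ quadClass a ↔ c = a ∨ c = -a ∨ c = q - a ∨ c = q + a := by
  simp [quadClass]

theorem quadClass_eq_of_mem {q : ℕ} (a c : ZMod (2 * q)) (h : c ∈ quadClass a) :
    quadClass c = quadClass a := by
  have hq := natCast_add_self q
  ext x
  rw [mem_quadClass] at h
  rw [mem_quadClass, mem_quadClass]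
  rcases h with rfl | rfl | rfl | rfl
  · rfl
  · rw [neg_neg, sub_neg_eq_add, ← sub_eq_add_neg]
    tauto
  · rw [show -((q : ZMod (2 * q)) - a) = q + a by linear_combination -hq,
      show (q : ZMod (2 * q)) - (q - a) = a by ring,
      show (q : ZMod (2 * q)) + (q - a) = -a by linear_combination hq]
    tauto
  · rw [show -((q : ZMod (2 * q)) + a) = q - a by linear_combination -hq,
      show (q : ZMod (2 * q)) - (q + a) = -a by ring,
      show (q : ZMod (2 * q)) + (q + a) = a by linear_combination hq]
    tauto

theorem self_mem_quadClass {q : ℕ} (a : ZMod (2 * q)) : a ∈ quadClass a :=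
  mem_quadClass.2 (Or.inl rfl)

theorem mem_quadClass_comm {q : ℕ} {a c : ZMod (2 * q)} : c ∈ quadClass a ↔ a ∈ quadClass c :=
  ⟨fun h => by rw [quadClass_eq_of_mem a c h]; exact self_mem_quadClass a,
    fun h => by rw [quadClass_eq_of_mem c a h]; exact self_mem_quadClass c⟩

/-- Doubling kills q, so the class of a is the preimage of {2a, -2a} under doubling. -/
theorem add_self_of_mem_quadClass {q : ℕ} {a c : ZMod (2 * q)} (h : c ∈ quadClass a) :
    c + c = a + a ∨ c + c = -(a + a) := by
  have hq := natCast_add_self q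
  rw [mem_quadClass] at h
  rcases h with rfl | rfl | rfl | rfl
  · exact Or.inl rfl
  · exact Or.inr (by ring)
  · exact Or.inr (by linear_combination hq)
  · exact Or.inl (by linear_combination hq)

theorem mem_quadClass_of_add_self_eq {q : ℕ} {a c : ZMod (2 * q)} (h : c + c = a + a) :
    c ∈ quadClass a := by
  rw [mem_quadClass]
  have : (c - a) + (c - a) = 0 := by linear_combination h
  rw [add_self_eq_zero_iff] at this
  rcases this with h | h
  · exact Or.inl (by linear_combination h)
  · exact Or.inr (Or.inr (Or.inr (by linear_combination h)))

/-- Two of the four expressions coincide only if 2a = 0, 2a = q or q = 0. -/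
theorem card_quadClass {q : ℕ} (hq0 : 0 < q) {a : ZMod (2 * q)} (h0 : a + a ≠ 0)
    (hq : a + a ≠ q) : (quadClass a).card = 4 := by
  have hqq := natCast_add_self q
  have hne := natCast_ne_zero hq0
  have h1 : a ≠ -a := fun h => h0 (by linear_combination h)
  have h2 : a ≠ q - a := fun h => hq (by linear_combination h)
  have h3 : a ≠ q + a := fun h => hne (by linear_combination -h)
  have h4 : -a ≠ q - a := fun h => hne (by linear_combination -h)
  have h5 : -a ≠ q + a := fun h => hq (by linear_combination -h - hqq)
  have h6 : (q : ZMod (2 * q)) - a ≠ q + a := fun h => h0 (by linear_combination -h)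
  rw [quadClass, Finset.card_insert_of_notMem (by simp [h1, h2, h3]),
    Finset.card_insert_of_notMem (by simp [h4, h5]), Finset.card_pair h6]

theorem parity_of_mem_quadClass {q : ℕ} (hq : 2 ∣ q) {a c : ZMod (2 * q)} (h : c ∈ quadClass a) :
    parity q c = parity q a := by
  have hparity : parity q (q : ZMod (2 * q)) = 0 := by
    rw [parity_natCast, ZMod.natCast_eq_zero_iff]
    exact hq
  rw [mem_quadClass] at h
  rcases h with rfl | rfl | rfl | rfl
  · rfl
  · exact parity_neg a
  · rw [map_sub, hparity, zero_sub, ZMod.neg_eq_self_mod_two]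
  · rw [map_add, hparity, zero_add]

theorem add_self_eq_iff {q r : ℕ} (hr : q = 4 * r) (a : ZMod (2 * q)) :
    a + a = q ↔ a = (2 * r : ℕ) ∨ a = (2 * r : ℕ) + q := by
  have hh : (((2 * r : ℕ) : ZMod (2 * q))) + (2 * r : ℕ) = q := by
    rw [← Nat.cast_add]
    congr 1
    omega
  have : a + a = q ↔ (a - (2 * r : ℕ)) + (a - (2 * r : ℕ)) = 0 :=
    ⟨fun h => by linear_combination h - hh, fun h => by linear_combination h + hh⟩
  rw [this, add_self_eq_zero_iff, sub_eq_zero, sub_eq_iff_eq_add']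

section Finite

variable {q : ℕ} [NeZero (2 * q)]

/-- The even elements `a` with four-element class. -/
def genericClass (q : ℕ) [NeZero (2 * q)] : Finset (ZMod (2 * q)) :=
  (parityClass q 0).filter fun a => a + a ≠ 0 ∧ a + a ≠ q

theorem filter_add_self_eq {r : ℕ} (hr : q = 4 * r) :
    (Finset.univ.filter fun a : ZMod (2 * q) => a + a = q) =
      {((2 * r : ℕ) : ZMod (2 * q)), ((2 * r : ℕ) : ZMod (2 * q)) + q} := by
  ext a
  simp only [Finset.mem_filter, Finset.mem_univ, true_and, Finset.mem_insert,
    Finset.mem_singleton]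
  exact add_self_eq_iff hr a

theorem card_filter_add_self_eq {r : ℕ} (hq0 : 0 < q) (hr : q = 4 * r) :
    (Finset.univ.filter fun a : ZMod (2 * q) => a + a = q).card = 2 := by
  rw [filter_add_self_eq hr, Finset.card_pair]
  intro h
  exact natCast_ne_zero hq0 (left_eq_add.1 h)

omit [NeZero (2 * q)] in
theorem parity_of_add_self_eq {r : ℕ} (hr : q = 4 * r) {a : ZMod (2 * q)} (ha : a + a = q) :
    parity q a = 0 := by
  have h1 : parity q ((2 * r : ℕ) : ZMod (2 * q)) = 0 := by
    rw [parity_natCast, ZMod.natCast_eq_zero_iff]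
    exact dvd_mul_right 2 r
  have h2 : parity q (q : ZMod (2 * q)) = 0 := by
    rw [parity_natCast, ZMod.natCast_eq_zero_iff]
    omega
  rcases (add_self_eq_iff hr a).1 ha with rfl | rfl
  · exact h1
  · rw [map_add, h1, h2, add_zero]

/-- Of the q even elements, 0 and q are removed, and so are the two solutions of 2a = q, which are
even because 4 ∣ q. -/
theorem card_genericClass {r : ℕ} (hq0 : 0 < q) (hr : q = 4 * r) :
    ((genericClass q).card : ℚ) = q - 4 := by
  have hsplit := Finset.card_filter_add_card_filter_not
    (s := (parityClass q 0).filter fun a => ¬ a + a = 0) (fun a : ZMod (2 * q) => a + a = q)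
  have h1 : (((parityClass q 0).filter fun a => ¬ a + a = 0).filter fun a : ZMod (2 * q) => a + a = q) =
      Finset.univ.filter fun a : ZMod (2 * q) => a + a = q := by
    ext a
    simp only [Finset.mem_filter, Finset.mem_univ, true_and, mem_parityClass, and_iff_right_iff_imp]
    intro h
    refine ⟨parity_of_add_self_eq hr h, fun h0 => natCast_ne_zero hq0 (h.symm.trans h0)⟩
  rw [h1, card_filter_add_self_eq hq0 hr, Finset.filter_filter] at hsplit
  have h2 := card_filter_not_add_self (q := q) 0
  rw [card_filter_add_self_zero hq0 (by omega), ← hsplit] at h2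
  push_cast at h2
  rw [genericClass]
  linarith

theorem card_apartTuples_quad {r : ℕ} (hq0 : 0 < q) (hr : q = 4 * r) (k : ℕ) :
    ((apartTuples quadClass k (genericClass q)).card : ℚ) =
      ∏ i ∈ Finset.range k, ((q : ℚ) - 4 * ((i : ℚ) + 1)) := by
  have hcard : ∀ a ∈ genericClass q, (quadClass a).card = 4 := by
    intro a ha
    rw [genericClass, Finset.mem_filter] at ha
    exact card_quadClass hq0 ha.2.1 ha.2.2
  rw [card_apartTuples quadClass 4 (by norm_num) self_mem_quadClass quadClass_eq_of_mem k _ ?_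
    (fun a ha => Or.inr (hcard a ha)), Finset.filter_true_of_mem hcard,
    Finset.filter_false_of_mem (fun a ha => by rw [hcard a ha]; norm_num), Finset.card_empty,
    Nat.cast_zero, tupleCount_zero, card_genericClass hq0 hr]
  · exact Finset.prod_congr rfl fun i _ => by push_cast; ring
  · intro a ha c hc
    rw [genericClass, Finset.mem_filter, mem_parityClass] at ha ⊢
    have hneg := neg_natCast_eq q
    refine ⟨by rw [parity_of_mem_quadClass (by omega) hc, ha.1], fun h => ?_, fun h => ?_⟩ <;>
      rcases add_self_of_mem_quadClass hc with h' | h' <;> rw [h] at h'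
    · exact ha.2.1 h'.symm
    · exact ha.2.1 (neg_eq_zero.1 h'.symm)
    · exact ha.2.2 h'.symm
    · exact ha.2.2 (by rw [← neg_neg (a + a), ← h', hneg])

/-- Half of a configuration that is fixed by a rotation of order four. -/
def IsHalfConfiguration (q k : ℕ) (w : Fin (k + 2) → ZMod (2 * q)) : Prop :=
  w 0 + w 0 = 0 ∧ w (Fin.last (k + 1)) + w (Fin.last (k + 1)) = q ∧
    (∀ i, parity q (w i) = 0) ∧ ∀ i j, i ≠ j → w i ∉ quadClass (w j)

theorem isHalfConfiguration_iff {r : ℕ} (hq0 : 0 < q) (hr : q = 4 * r) (k : ℕ)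
    (w : Fin (k + 2) → ZMod (2 * q)) :
    IsHalfConfiguration q k w ↔ (w 0, w (Fin.last (k + 1))) ∈
        ({0, (q : ZMod (2 * q))} : Finset (ZMod (2 * q))) ×ˢ
          (Finset.univ.filter fun a : ZMod (2 * q) => a + a = q) ∧
      (fun i : Fin k => w i.castSucc.succ) ∈ apartTuples quadClass k (genericClass q) := by
  have hne := natCast_ne_zero hq0
  have hneg := neg_natCast_eq q
  have hparity : parity q (q : ZMod (2 * q)) = 0 := by
    rw [parity_natCast, ZMod.natCast_eq_zero_iff]
    omega
  simp only [Finset.mem_product, Finset.mem_insert, Finset.mem_singleton, Finset.mem_filter,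
    Finset.mem_univ, true_and, mem_apartTuples, genericClass, mem_parityClass]
  rw [← add_self_eq_zero_iff]
  constructor
  · rintro ⟨h0, h1, hpar, hK⟩
    refine ⟨⟨h0, h1⟩, fun i => ⟨hpar _, fun h => ?_, fun h => ?_⟩, fun i j hij => hK _ _ fun h =>
      hij (Fin.castSucc_injective _ (Fin.succ_injective _ h))⟩
    · exact hK i.castSucc.succ 0 (Fin.succ_ne_zero _)
        (mem_quadClass_of_add_self_eq (h.trans h0.symm))
    · exact hK i.castSucc.succ (Fin.last (k + 1)) (by simp [Fin.ext_iff]; omega)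
        (mem_quadClass_of_add_self_eq (h.trans h1.symm))
  · rintro ⟨⟨h0, h1⟩, hmid, hK⟩
    have hcases : ∀ j, j = 0 ∨ j = Fin.last (k + 1) ∨ ∃ i : Fin k, j = i.castSucc.succ := by
      intro j
      refine Fin.cases (Or.inl rfl) (fun j => Or.inr ?_) j
      refine Fin.lastCases (Or.inl (Fin.succ_last k)) (fun j => Or.inr ⟨j, rfl⟩) j
    have h01 : w (Fin.last (k + 1)) ∉ quadClass (w 0) := by
      intro h
      apply hne
      rcases add_self_of_mem_quadClass h with h | h <;> rw [h0, h1] at h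
      · exact h
      · rw [h, neg_zero]
    have hm0 : ∀ i : Fin k, w i.castSucc.succ ∉ quadClass (w 0) := by
      intro i h
      apply (hmid i).2.1
      rcases add_self_of_mem_quadClass h with h | h <;> rw [h, h0]
      exact neg_zero
    have hm1 : ∀ i : Fin k, w i.castSucc.succ ∉ quadClass (w (Fin.last (k + 1))) := by
      intro i h
      apply (hmid i).2.2
      rcases add_self_of_mem_quadClass h with h | h <;> rw [h, h1]
      exact hneg
    refine ⟨h0, h1, fun j => ?_, fun i j hij => ?_⟩
    · rcases hcases j with rfl | rfl | ⟨i, rfl⟩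
      · rcases (add_self_eq_zero_iff _).1 h0 with h | h <;> rw [h]
        exacts [map_zero _, hparity]
      · exact parity_of_add_self_eq hr h1
      · exact (hmid i).1
    · rcases hcases i with rfl | rfl | ⟨i, rfl⟩ <;> rcases hcases j with rfl | rfl | ⟨j, rfl⟩
      · exact absurd rfl hij
      · rwa [mem_quadClass_comm]
      · rw [mem_quadClass_comm]
        exact hm0 j
      · exact h01
      · exact absurd rfl hij
      · rw [mem_quadClass_comm]
        exact hm1 j
      · exact hm0 i
      · exact hm1 i
      · exact hK i j fun h => hij (by rw [h])

theorem card_isHalfConfiguration {r : ℕ} (hq0 : 0 < q) (hr : q = 4 * r) (k : ℕ) :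
    (Nat.card {w : Fin (k + 2) → ZMod (2 * q) // IsHalfConfiguration q k w} : ℚ) =
      4 * ∏ i ∈ Finset.range k, ((q : ℚ) - 4 * ((i : ℚ) + 1)) := by
  classical
  simp only [isHalfConfiguration_iff hq0 hr]
  rw [Nat.card_eq_fintype_card, Fintype.card_subtype, card_filter_ends, Finset.card_product,
    card_filter_add_self_eq hq0 hr, Finset.card_pair (natCast_ne_zero hq0).symm, Nat.cast_mul,
    card_apartTuples_quad hq0 hr]
  norm_num

end Finite

/-! ### Configurations fixed by ω_{ℓ-1} and ω_ℓ -/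

theorem isFixedBy_rev_iff {m q : ℕ} {y : Fin (m + 2) → ZMod (2 * q)} (hy : IsConfiguration q y) :
    IsFixedBy q Fin.revPerm (fun k => if k = 0 then 1 else -1) y ↔
      y 0 + y 0 = 0 ∧ ∀ j, y j.rev = q - y j := by
  have hqq := natCast_add_self q
  have hlast : (0 : Fin (m + 2)) ≠ Fin.last (m + 1) := by simp [Fin.ext_iff]
  constructor
  · rintro (h | h)
    -- Without the translation the first and last entries would be equal.
    · have h0 := h 0
      simp only [if_true, Fin.revPerm_apply, Fin.rev_zero] at h0
      push_cast at h0
      rw [one_mul] at h0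
      exact absurd h0.symm (hy.2 _ _ hlast).1
    · have h0 := h 0
      simp only [if_true, Fin.revPerm_apply, Fin.rev_zero] at h0
      push_cast at h0
      rw [one_mul] at h0
      have h1 := h (Fin.last (m + 1))
      simp only [if_neg hlast.symm, Fin.revPerm_apply, Fin.rev_last] at h1
      push_cast at h1
      -- The equations at the two ends are y_last = y_0 + q and -y_0 = y_last + q.
      have h00 : y 0 + y 0 = 0 := by linear_combination -h1 - h0 - hqq
      refine ⟨h00, fun j => ?_⟩
      by_cases hj : j = 0
      · subst hj
        rw [Fin.rev_zero, h0]
        linear_combination h00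
      · have := h j
        simp only [if_neg hj, Fin.revPerm_apply] at this
        push_cast at this
        linear_combination -this - hqq
  · rintro ⟨h0, h⟩
    right
    intro j
    by_cases hj : j = 0
    · subst hj
      simp only [if_true, Fin.revPerm_apply, h]
      push_cast
      linear_combination -h0
    · simp only [if_neg hj, Fin.revPerm_apply, h]
      push_cast
      linear_combination -hqq

theorem four_dvd_of_isFixedBy_rev {k q : ℕ} {y : Fin (2 * k + 1 + 2) → ZMod (2 * q)}
    (hy : IsConfiguration q y)
    (hfix : IsFixedBy q Fin.revPerm (fun k => if k = 0 then 1 else -1) y) : 4 ∣ q := by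
  rw [isFixedBy_rev_iff hy] at hfix
  obtain ⟨h0, hrev⟩ := hfix
  -- The number of coordinates is odd, so the middle one is its own mirror image.
  have hmid := hrev ⟨k + 1, by omega⟩
  have hmid' : (⟨k + 1, by omega⟩ : Fin (2 * k + 1 + 2)).rev = ⟨k + 1, by omega⟩ := by
    simp only [Fin.rev, Fin.mk.injEq]
    omega
  rw [hmid'] at hmid
  set c := y ⟨k + 1, by omega⟩ with hc
  have hcc : c + c = q := by linear_combination hmid
  have hq2 : 2 ∣ q := by
    have := congrArg (parity q) hcc
    rw [map_add, CharTwo.add_self_eq_zero, parity_natCast, eq_comm, ZMod.natCast_eq_zero_iff] at this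
    exact this
  have hparity : parity q (q : ZMod (2 * q)) = 0 := by
    rw [parity_natCast, ZMod.natCast_eq_zero_iff]
    exact hq2
  have hpar0 : parity q (y 0) = 0 := by
    rcases (add_self_eq_zero_iff _).1 h0 with h | h <;> rw [h]
    exacts [map_zero _, hparity]
  have hparc : parity q c = 0 := (hy.1 _ 0).trans hpar0
  obtain ⟨v, hv⟩ := ZMod.intCast_surjective c
  rw [← hv, map_intCast, ZMod.intCast_zmod_eq_zero_iff_dvd] at hparc
  rw [← hv, ← sub_eq_zero, ← Int.cast_add, ← Int.cast_natCast, ← Int.cast_sub,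
    ZMod.intCast_zmod_eq_zero_iff_dvd] at hcc
  obtain ⟨s, hs⟩ := hparc
  obtain ⟨r, hr⟩ := hq2
  -- Since q is even, 4 divides 2q; and v is even because the parity is that of y_0 ∈ {0, q}. So 4
  -- divides both 2v - q and 2v.
  have h4 : (4 : ℤ) ∣ v + v - q := by
    refine dvd_trans ⟨r, ?_⟩ hcc
    rw [hr]
    push_cast
    ring
  push_cast at hs
  omega

/-- The position of `j` or of its mirror image in the first half. -/
def foldIndex (k : ℕ) (j : Fin (2 * k + 1 + 2)) : Fin (k + 2) :=
  ⟨min j.val (2 * k + 2 - j.val), by omega⟩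

/-- The symmetric tuple determined by its first half. -/
def unfoldTuple {k q : ℕ} (w : Fin (k + 2) → ZMod (2 * q)) (j : Fin (2 * k + 1 + 2)) :
    ZMod (2 * q) :=
  if j.val ≤ k + 1 then w (foldIndex k j) else q - w (foldIndex k j)

theorem unfoldTuple_mem_quadClass {k q : ℕ} (w : Fin (k + 2) → ZMod (2 * q))
    (j : Fin (2 * k + 1 + 2)) : unfoldTuple w j ∈ quadClass (w (foldIndex k j)) := by
  rw [unfoldTuple, mem_quadClass]
  split_ifs <;> simp

theorem foldIndex_rev {k : ℕ} (j : Fin (2 * k + 1 + 2)) :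
    foldIndex k j.rev = foldIndex k j := by
  ext
  simp only [foldIndex, Fin.val_rev]
  omega

theorem unfoldTuple_rev {k q : ℕ} {w : Fin (k + 2) → ZMod (2 * q)}
    (hw : w (Fin.last (k + 1)) + w (Fin.last (k + 1)) = q) (j : Fin (2 * k + 1 + 2)) :
    unfoldTuple w j.rev = q - unfoldTuple w j := by
  rw [unfoldTuple, unfoldTuple, foldIndex_rev]
  have hj := Fin.val_rev j
  split_ifs with h1 h2 h2
  · have : foldIndex k j = Fin.last (k + 1) := by
      ext
      simp only [foldIndex, Fin.val_last]
      omega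
    rw [this]
    linear_combination hw
  · ring
  · rfl
  · omega

theorem isConfiguration_unfoldTuple {k q : ℕ} (hq0 : 0 < q) (hq : 2 ∣ q)
    {w : Fin (k + 2) → ZMod (2 * q)} (hw : IsHalfConfiguration q k w) :
    IsConfiguration q (unfoldTuple w) := by
  obtain ⟨h0, h1, hpar, hK⟩ := hw
  have hqq := natCast_add_self q
  have hpar' : ∀ j, parity q (unfoldTuple w j) = 0 := fun j => by
    rw [parity_of_mem_quadClass hq (unfoldTuple_mem_quadClass w j), hpar]
  refine ⟨fun i j => by rw [hpar', hpar'], fun i j hij => ?_⟩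
  have hi := unfoldTuple_mem_quadClass w i
  have hj := unfoldTuple_mem_quadClass w j
  -- Distinct positions with the same fold are mirror images. There u = q - u would put a non-middle
  -- entry in the class of the middle one, and u = -(q - u) would give q = 0. Different folds give
  -- different classes.
  by_cases hfold : foldIndex k i = foldIndex k j
  · have hfold' := congrArg Fin.val hfold
    have hne : i.val ≠ j.val := fun h => hij (Fin.ext h)
    simp only [foldIndex] at hfold'
    have hrev : j = i.rev := by
      ext
      rw [Fin.val_rev]
      omega
    have hlast : foldIndex k i ≠ Fin.last (k + 1) := by
      intro h
      have := congrArg Fin.val h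
      simp only [foldIndex, Fin.val_last] at this
      omega
    rw [hrev, unfoldTuple_rev h1]
    refine ⟨fun h => ?_, fun h => natCast_ne_zero hq0 (by linear_combination h)⟩
    have h2 : unfoldTuple w i + unfoldTuple w i = q := by linear_combination h
    apply hK _ _ hlast
    apply mem_quadClass_of_add_self_eq
    rw [h1]
    rcases add_self_of_mem_quadClass hi with h3 | h3 <;> rw [h2] at h3
    · exact h3.symm
    · linear_combination h3 - hqq
  · have key : unfoldTuple w i ∉ quadClass (unfoldTuple w j) := by
      intro h
      apply hK _ _ hfold
      rw [← quadClass_eq_of_mem _ _ hj, ← quadClass_eq_of_mem _ _ h, quadClass_eq_of_mem _ _ hi]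
      exact self_mem_quadClass _
    rw [mem_quadClass] at key
    tauto

/-- Restriction to the first half inverts `unfoldTuple`. The factor 4 counts the choices of the
first entry (0 or q) and of the middle entry (two solutions of 2c = q). -/
theorem card_omega_last {k q : ℕ} (hq0 : 0 < q) (hq : 4 ∣ q) :
    (Nat.card {y : Fin (2 * k + 1 + 2) → ZMod (2 * q) // IsConfiguration q y ∧
      IsFixedBy q Fin.revPerm (fun k => if k = 0 then 1 else -1) y} : ℚ) =
        4 * ∏ i ∈ Finset.range k, ((q : ℚ) - 4 * ((i : ℚ) + 1)) := by
  obtain ⟨r, hr⟩ := hq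
  have hq2 : 2 ∣ q := by omega
  have : NeZero (2 * q) := ⟨by omega⟩
  have hqq := natCast_add_self q
  have hparity : parity q (q : ZMod (2 * q)) = 0 := by
    rw [parity_natCast, ZMod.natCast_eq_zero_iff]
    exact hq2
  rw [← card_isHalfConfiguration hq0 hr, Nat.cast_inj]
  symm
  have hle : k + 2 ≤ 2 * k + 1 + 2 := by omega
  have hfold : ∀ i : Fin (k + 2), foldIndex k (Fin.castLE hle i) = i := by
    intro i
    ext
    simp only [foldIndex, Fin.val_castLE]
    omega
  have hunfold : ∀ (w : Fin (k + 2) → ZMod (2 * q)) (i : Fin (k + 2)),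
      unfoldTuple w (Fin.castLE hle i) = w i := by
    intro w i
    rw [unfoldTuple, if_pos (by rw [Fin.val_castLE]; omega), hfold]
  refine Nat.card_eq_of_bijective (fun w => ⟨unfoldTuple w.1,
    isConfiguration_unfoldTuple hq0 hq2 w.2,
    (isFixedBy_rev_iff (isConfiguration_unfoldTuple hq0 hq2 w.2)).2 ⟨?_, ?_⟩⟩) ⟨?_, ?_⟩
  · have h0 : unfoldTuple w.1 0 = w.1 0 := hunfold w.1 0
    rw [h0]
    exact w.2.1
  · exact unfoldTuple_rev w.2.2.1
  · intro w w' h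
    have h' : unfoldTuple w.1 = unfoldTuple w'.1 := congrArg Subtype.val h
    apply Subtype.ext
    ext i
    rw [← hunfold w.1, ← hunfold w'.1, h']
  · rintro ⟨y, hy, hfix⟩
    have hfix' := hfix
    rw [isFixedBy_rev_iff hy] at hfix'
    obtain ⟨h0, hrev⟩ := hfix'
    have hpar : ∀ j, parity q (y j) = 0 := by
      intro j
      rw [hy.1 j 0]
      rcases (add_self_eq_zero_iff _).1 h0 with h | h <;> rw [h]
      exacts [map_zero _, hparity]
    have hhalf : IsHalfConfiguration q k (fun i => y (Fin.castLE hle i)) := by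
      refine ⟨h0, ?_, fun i => hpar _, fun i j hij h => ?_⟩
      · have hm : (Fin.castLE hle (Fin.last (k + 1))).rev = Fin.castLE hle (Fin.last (k + 1)) := by
          ext
          simp only [Fin.val_rev, Fin.val_castLE, Fin.val_last]
          omega
        have := hrev (Fin.castLE hle (Fin.last (k + 1)))
        rw [hm] at this
        linear_combination this
      · have hne : i.val ≠ j.val := fun h => hij (Fin.ext h)
        -- Being different up to sign from both y_j and its mirror image q - y_j excludes all four
        -- members of the class of y_j.
        obtain ⟨h1, h2⟩ := hy.2 (Fin.castLE hle i) (Fin.castLE hle j) fun h =>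
          hij (Fin.castLE_injective hle h)
        obtain ⟨h3, h4⟩ := hy.2 (Fin.castLE hle i) (Fin.castLE hle j).rev fun h => by
          have := congrArg Fin.val h
          simp only [Fin.val_rev, Fin.val_castLE] at this
          omega
        rw [hrev] at h3 h4
        rw [mem_quadClass] at h
        rcases h with h | h | h | h
        · exact h1 h
        · exact h2 h
        · exact h3 h
        · exact h4 (by linear_combination h + hqq)
    refine ⟨⟨_, hhalf⟩, Subtype.ext (funext fun j => ?_)⟩
    change unfoldTuple (fun i => y (Fin.castLE hle i)) j = y j
    rw [unfoldTuple]
    split_ifs with hj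
    · congr 1
      ext
      simp only [foldIndex, Fin.val_castLE]
      omega
    · rw [← hrev]
      congr 1
      ext
      simp only [foldIndex, Fin.val_castLE, Fin.val_rev]
      omega

end Quarter

/-! ### Values of the character -/

section Values

variable {ι M N : Type*} [AddCommGroup M] [Module ℝ M] [AddCommGroup N] [Module ℝ N]
  {P : RootPairing ι ℝ M N}

/-- The square changes the signs of exactly the first and last coordinates, so it is a nontrivial
involution. -/
theorem orderOf_of_actsBy_rev {n : ℕ} {φ : N ≃ₗ[ℝ] (Fin (n + 2) → ℝ)} {w : P.weylGroup}
    (hw : ActsBy φ w Fin.revPerm (fun k => if k = 0 then 1 else -1)) : orderOf w = 4 := by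
  have hlast : Fin.last (n + 1) ≠ 0 := by simp [Fin.ext_iff]
  have hsq := hw.mul hw
  have h4 := hsq.mul hsq
  have hrev : (Fin.revPerm * Fin.revPerm : Equiv.Perm (Fin (n + 2))) = 1 := by
    ext k
    simp
  rw [hrev] at hsq
  rw [hrev, one_mul] at h4
  refine orderOf_eq_prime_pow (p := 2) (n := 1) (fun h => ?_) ?_
  · rw [pow_one, sq] at h
    have := hsq (φ.symm (Pi.single 0 1)) 0
    rw [h, map_one, LinearEquiv.coe_one, id, LinearEquiv.apply_symm_apply] at this
    simp [hlast] at this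
    norm_num at this
  · rw [show 2 ^ (1 + 1) = 2 + 2 by norm_num, pow_add, sq]
    refine ActsBy.unique (σ := 1) (ε := 1) (φ := φ) ?_ actsBy_one
    convert! h4 using 1
    ext k : 1
    exact (Int.units_mul_self _).symm

variable [Finite ι] [P.IsCrystallographic] [P.IsReduced] {b : P.Base}

theorem value_one {n : ℕ} {e : Fin (n + 2) ≃ b.support} {φ : N ≃ₗ[ℝ] (Fin (n + 2) → ℝ)}
    (h : IsStandard b e φ) {q : ℕ} (hq : 0 < q) :
    2 * (equivChar P q 1 : ℚ) =
      Nat.card {y : Fin (n + 2) → ZMod (2 * q) // IsConfiguration q y} := by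
  have hfix : ∀ y : Fin (n + 2) → ZMod (2 * q), IsFixedBy q 1 1 y := fun y => Or.inl (by simp)
  have := two_mul_equivChar h hq (actsBy_one (P := P) (φ := φ))
  simp only [hfix, and_true] at this
  exact_mod_cast this

theorem values_quarter {k : ℕ} {e : Fin (2 * k + 1 + 2) ≃ b.support}
    {φ : N ≃ₗ[ℝ] (Fin (2 * k + 1 + 2) → ℝ)} (h : IsStandard b e φ) {w : P.weylGroup}
    (hw : ActsBy φ w Fin.revPerm (fun k => if k = 0 then 1 else -1)) :
    orderOf w = 4 ∧ (∀ q : ℕ, 0 < q → ¬ 4 ∣ q → equivChar P q w = 0) ∧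
      ∀ q : ℕ, 0 < q → 4 ∣ q → (equivChar P q w : ℚ) =
        2 * ∏ i ∈ Finset.range k, ((q : ℚ) - 4 * ((i : ℚ) + 1)) := by
  refine ⟨orderOf_of_actsBy_rev hw, fun q hq hq4 => ?_, fun q hq hq4 => ?_⟩
  · have h2 := two_mul_equivChar h hq hw
    have : IsEmpty {y : Fin (2 * k + 1 + 2) → ZMod (2 * q) // IsConfiguration q y ∧
        IsFixedBy q Fin.revPerm (fun k => if k = 0 then 1 else -1) y} :=
      ⟨fun y => hq4 (four_dvd_of_isFixedBy_rev y.2.1 y.2.2)⟩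
    rw [Nat.card_of_isEmpty] at h2
    omega
  · have h2 : (2 : ℚ) * equivChar P q w = _ :=
      (by exact_mod_cast two_mul_equivChar h hq hw : _ = ((Nat.card _ : ℕ) : ℚ)).trans
        (card_omega_last hq hq4)
    linarith

end Values

end EquivariantQuasi

theorem mainTheorem10 {ι M N : Type*} [Finite ι] [AddCommGroup M] [Module ℝ M]
    [AddCommGroup N] [Module ℝ N] (P : RootPairing ι ℝ M N)
    [P.IsRootSystem] [P.IsCrystallographic] [P.IsReduced] (b : P.Base)
    (ℓ : ℕ) (hℓ : 4 ≤ ℓ) (hodd : Odd ℓ) (e : Fin ℓ ≃ b.support)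
    (hD : EquivariantQuasi.IsTypeD b e) :
    -- the value at `1`
    (∀ q : ℕ, 0 < q → ¬ 2 ∣ q →
      (EquivariantQuasi.equivChar P q 1 : ℚ) =
        (∏ i ∈ Finset.range (ℓ - 1), ((q : ℚ) - (2 * (i : ℚ) + 1))) *
          ((q : ℚ) - ((ℓ : ℚ) - 1))) ∧
    (∀ q : ℕ, 0 < q → 2 ∣ q →
      (EquivariantQuasi.equivChar P q 1 : ℚ) =
        (∏ i ∈ Finset.range (ℓ - 2), ((q : ℚ) - 2 * ((i : ℚ) + 1))) *
          ((q : ℚ) ^ 2 - 2 * ((ℓ : ℚ) - 1) * q + (ℓ : ℚ) * ((ℓ : ℚ) - 1) / 2)) ∧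
    -- the value at `ω_1`
    (∀ q : ℕ, 0 < q → ¬ 2 ∣ q →
      EquivariantQuasi.equivChar P q
        (EquivariantQuasi.omega b (e ⟨0, by omega⟩)) = 0) ∧
    (∀ q : ℕ, 0 < q → 2 ∣ q →
      (EquivariantQuasi.equivChar P q
        (EquivariantQuasi.omega b (e ⟨0, by omega⟩)) : ℚ) =
          ∏ i ∈ Finset.range (ℓ - 2), ((q : ℚ) - 2 * ((i : ℚ) + 1))) ∧
    -- the values at `ω_{ℓ-1}` and `ω_ℓ`
    (∀ ω : P.weylGroup,
      ω = EquivariantQuasi.omega b (e ⟨ℓ - 2, by omega⟩) ∨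
        ω = EquivariantQuasi.omega b (e ⟨ℓ - 1, by omega⟩) →
      orderOf ω = 4 ∧
      (∀ q : ℕ, 0 < q → ¬ 4 ∣ q → EquivariantQuasi.equivChar P q ω = 0) ∧
      (∀ q : ℕ, 0 < q → 4 ∣ q →
        (EquivariantQuasi.equivChar P q ω : ℚ) =
          2 * ∏ i ∈ Finset.range ((ℓ - 3) / 2), ((q : ℚ) - 4 * ((i : ℚ) + 1)))) := by
  obtain ⟨k, rfl⟩ : ∃ k, ℓ = 2 * k + 1 + 2 := by
    obtain ⟨m, rfl⟩ := hodd
    exact ⟨m - 1, by omega⟩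
  have hn : 2 ≤ 2 * k + 1 := by omega
  have hnodd : Odd (2 * k + 1) := ⟨k, rfl⟩
  obtain ⟨φ, hφ⟩ := EquivariantQuasi.exists_isStandard b hn e hD
  -- In the coordinates `ψ` the fork nodes are exchanged, so α_{ℓ-1} takes the last place and
  -- ω_{ℓ-1} has the form found for ω_ℓ.
  obtain ⟨ψ, hψ⟩ := EquivariantQuasi.exists_isStandard b hn _ (hD.swap hn)
  have hzero := hφ.actsBy_omega_zero hnodd
  have hlast := hφ.actsBy_omega_last hnodd
  have hlast' := hψ.actsBy_omega_last hnodd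
  rw [Equiv.trans_apply, Equiv.swap_apply_right] at hlast'
  refine ⟨fun q hq hq2 => ?_, fun q hq hq2 => ?_, fun q hq hq2 => ?_, fun q hq hq2 => ?_, ?_⟩
  · have h1 := EquivariantQuasi.value_one hφ hq
    have : NeZero (2 * q) := ⟨by omega⟩
    rw [EquivariantQuasi.card_isConfiguration_of_odd hq2] at h1
    refine (mul_left_cancel₀ two_ne_zero h1).trans ?_
    congr 1
    push_cast
    ring
  · have h1 := EquivariantQuasi.value_one hφ hq
    have : NeZero (2 * q) := ⟨by omega⟩
    rw [EquivariantQuasi.card_isConfiguration_of_even hq hq2] at h1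
    refine (mul_left_cancel₀ two_ne_zero h1).trans ?_
    congr 1
    push_cast
    ring
  · have h1 := EquivariantQuasi.two_mul_equivChar hφ hq hzero
    rw [EquivariantQuasi.card_omega_zero_of_odd hq (by omega) hq2] at h1
    have h0 : (⟨0, by omega⟩ : Fin (2 * k + 1 + 2)) = 0 := rfl
    rw [h0]
    omega
  · have h1 := EquivariantQuasi.two_mul_equivChar hφ hq hzero
    have h2 := EquivariantQuasi.card_omega_zero_of_even (n := 2 * k + 1) hq (by omega) hq2
    rw [← h1, Nat.cast_mul, Nat.cast_ofNat] at h2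
    exact mul_left_cancel₀ two_ne_zero h2
  · have hrange : (2 * k + 1 + 2 - 3) / 2 = k := by omega
    rw [hrange]
    rintro ω (rfl | rfl)
    · exact EquivariantQuasi.values_quarter hψ hlast'
    · exact EquivariantQuasi.values_quarter hφ hlast
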